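/- Let $K\in\{\mathbb R,\mathbb C\}$. A topological $K$-vector space is *weakly complete* if it is isomorphic to a power $K^J$; a *weakly complete unital algebra* is a topological unital associative $K$-algebra whose underlying topological vector space is weakly complete. The tensor product $E\otimes_{\mathcal W}F$ of weakly complete spaces is $(E'\otimes F')^*$, the algebraic dual of the tensor product of the topological duals, with the topology of pointwise convergence; a weakly complete symmetric Hopf algebra is a group object in the monoidal category of weakly complete spaces with $\otimes_{\mathcal W}$, i.e. a weakly complete unital algebra with comultiplication, coidentity and symmetry (antipode). Let $\mathfrak g$ be a weakly complete $K$-vector space, regarded as an abelian Lie algebra, with topological dual $\mathfrak g'$. A *weakly complete enveloping algebra* of $\mathfrak g$ is a weakly complete unital algebra $\mathbf U(\mathfrak g)$ with a continuous Lie algebra morphism $\lambda\colon\mathfrak g\to\mathbf U(\mathfrak g)$ (for the bracket $ab-ba$) such that every continuous Lie algebra morphism $f$ from $\mathfrak g$ to a weakly complete unital algebra $A$ is $f'\circ\lambda$ for a unique continuous unital algebra morphism $f'\colon\mathbf U(\mathfrak g)\to A$. On $\mathbf U(\mathfrak g)$ let the comultiplication and the coidentity be the continuous unital algebra morphisms with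 $\lambda(x)\mapsto\lambda(x)\otimes1+1\otimes\lambda(x)$ and $\lambda(x)\mapsto0$, and let the symmetry be the continuous unital algebra anti-morphism with $\lambda(x)\mapsto-\lambda(x)$. Let $\mathbf V(\mathfrak g)=K^{\mathfrak g'}$ with componentwise operations, comultiplication $c(\varphi)(\omega_1,\omega_2)=\varphi(\omega_1+\omega_2)$ (identifying $K^{\mathfrak g'}\otimes_{\mathcal W}K^{\mathfrak g'}$ with $K^{\mathfrak g'\times\mathfrak g'}$), coidentity $\varphi\mapsto\varphi(0)$, symmetry $\sigma(\varphi)(\omega)=\varphi(-\omega)$, and let $\nu\colon\mathfrak g\to\mathbf V(\mathfrak g)$, $\nu(x)(\omega)=\omega(x)$. Call a weakly complete unital algebra *semisimple* if its continuous unital algebra morphisms to $K$ separate its points, and let the radical $R(A)$ be the intersection of the kernels of all continuous unital algebra morphisms $A\to K$. **Proposition.** A weakly complete enveloping algebra $\mathbf U(\mathfrak g)$ exists. For each such $\mathbf U(\mathfrak g)$, both $\mathbf U(\mathfrak g)$ and $\mathbf V(\mathfrak g)$ are weakly complete symmetric Hopf algebras with the structures above, and the unique continuous unital algebra morphism $q_{\mathfrak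 g}\colon\mathbf U(\mathfrak g)\to\mathbf V(\mathfrak g)$ with $q_{\mathfrak g}\circ\lambda=\nu$ is a surjective morphism of weakly complete symmetric Hopf algebras (it respects comultiplications, coidentities and symmetries), with $$\ker q_{\mathfrak g}=R(\mathbf U(\mathfrak g)).$$ If $K=\mathbb C$, then $\ker q_{\mathfrak g}$ is also the Jacobson radical of $\mathbf U(\mathfrak g)$. -/

import Mathlib

open scoped TensorProduct

universe u v w x y

/-! ## Weakly complete vector spaces

`K` is one of the topological fields `ℝ`, `ℂ` (`RCLike K`, `K : Type`). -/

/-- A topological vector space over `K` is weakly complete if it is isomorphic, as a topological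
vector space, to a power `K ^ J`. -/
class IsWeaklyComplete (K : Type) [RCLike K] (E : Type u) [AddCommGroup E] [Module K E]
    [TopologicalSpace E] : Prop where
  exists_equiv_pi : ∃ J : Type u, Nonempty (E ≃L[K] (J → K))

namespace WeaklyComplete

noncomputable section

variable (K : Type) [RCLike K]

/-- The topological dual `E'` of continuous linear functionals, as an abstract vector space. -/
abbrev TopDual (E : Type u) [AddCommGroup E] [Module K E] [TopologicalSpace E] : Type u :=
  E →L[K] K

instance isWeaklyComplete_pi (J : Type u) : IsWeaklyComplete K (J → K) :=
  ⟨⟨J, ⟨ContinuousLinearEquiv.refl K _⟩⟩⟩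

variable {K}

theorem isWeaklyComplete_of_equiv {E F : Type u} [AddCommGroup E] [Module K E]
    [TopologicalSpace E] [AddCommGroup F] [Module K F] [TopologicalSpace F]
    [h : IsWeaklyComplete K E] (e : F ≃L[K] E) : IsWeaklyComplete K F := by
  obtain ⟨J, ⟨f⟩⟩ := h.exists_equiv_pi
  exact ⟨⟨J, ⟨e.trans f⟩⟩⟩

instance isWeaklyComplete_mulOpposite {A : Type u} [Ring A] [Algebra K A] [TopologicalSpace A]
    [IsWeaklyComplete K A] : IsWeaklyComplete K Aᵐᵒᵖ :=
  isWeaklyComplete_of_equiv (MulOpposite.opContinuousLinearEquiv K).symm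

variable (K) in
/-- The field `K`, lifted to the universe `u`. -/
def uliftEquiv : ULift.{u} K ≃L[K] (PUnit.{u + 1} → K) where
  toFun x := fun _ => x.down
  invFun f := ⟨f PUnit.unit⟩
  map_add' _ _ := rfl
  map_smul' _ _ := rfl
  left_inv _ := rfl
  right_inv _ := rfl
  continuous_toFun := continuous_pi fun _ => continuous_uliftDown
  continuous_invFun := continuous_uliftUp.comp (continuous_apply _)

instance isWeaklyComplete_self : IsWeaklyComplete K K :=
  isWeaklyComplete_of_equiv
    ((uliftEquiv.{0} K).symm.trans ContinuousLinearEquiv.ulift).symm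

instance isWeaklyComplete_ulift : IsWeaklyComplete K (ULift.{u} K) :=
  isWeaklyComplete_of_equiv (uliftEquiv K)

/-! ### Duality of weakly complete vector spaces -/

section Duality

variable {E : Type u} {F : Type v} {Z : Type w} [AddCommGroup E] [Module K E] [TopologicalSpace E]
  [AddCommGroup F] [Module K F] [TopologicalSpace F]
  [AddCommGroup Z] [Module K Z] [TopologicalSpace Z]

/-- The continuous linear functional "`j`-th coordinate" of an isomorphism `E ≅ K ^ J`. -/
def coord {J : Type u} (e : E ≃L[K] (J → K)) (j : J) : TopDual K E :=
  (ContinuousLinearMap.proj j).comp (e : E →L[K] (J → K))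

theorem mem_span_coord {J : Type u} (e : E ≃L[K] (J → K)) (φ : TopDual K E) :
    φ ∈ Submodule.span K (Set.range (coord e)) := by
  have h1 : ((φ.comp (e.symm : (J → K) →L[K] E) : (J → K) →L[K] K) : (J → K) →ₗ[K] K) ∈
      Submodule.span K (Set.range fun j => (LinearMap.proj j : (J → K) →ₗ[K] K)) := by
    rw [LinearMap.mem_span_iff_continuous]
    exact (φ.comp (e.symm : (J → K) →L[K] E)).continuous
  rw [Finsupp.mem_span_range_iff_exists_finsupp] at h1 ⊢
  obtain ⟨c, hc⟩ := h1
  refine ⟨c, ?_⟩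
  ext x
  have := LinearMap.congr_fun hc (e x)
  simpa [Finsupp.sum, coord] using this

variable (K E) in
/-- The canonical map from `E` to the algebraic dual of `E'`. -/
def bidual : E →ₗ[K] Module.Dual K (TopDual K E) where
  toFun x :=
    { toFun := fun φ => φ x
      map_add' := fun _ _ => rfl
      map_smul' := fun _ _ => rfl }
  map_add' x y := by ext φ; simp
  map_smul' c x := by ext φ; simp

@[simp] theorem bidual_apply (x : E) (φ : TopDual K E) : bidual K E x φ = φ x := rfl

theorem bidual_bijective [h : IsWeaklyComplete K E] : Function.Bijective (bidual K E) := by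
  obtain ⟨J, ⟨e⟩⟩ := h.exists_equiv_pi
  constructor
  · intro x y hxy
    apply e.injective
    funext j
    exact LinearMap.congr_fun hxy (coord e j)
  · intro Φ
    refine ⟨e.symm fun j => Φ (coord e j), ?_⟩
    ext φ
    have := mem_span_coord e φ
    induction this using Submodule.span_induction with
    | mem φ hφ =>
      obtain ⟨j, rfl⟩ := hφ
      simp [coord]
    | zero => simp
    | add a b _ _ ha hb => simp_all
    | smul c a _ ha => simp_all

variable (K E) in
/-- The duality isomorphism `E ≅ (E')^*` of a weakly complete vector space. -/
def bidualEquiv [IsWeaklyComplete K E] : E ≃ₗ[K] Module.Dual K (TopDual K E) :=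
  LinearEquiv.ofBijective (bidual K E) bidual_bijective

@[simp] theorem apply_bidualEquiv_symm [IsWeaklyComplete K E]
    (Φ : Module.Dual K (TopDual K E)) (φ : TopDual K E) : φ ((bidualEquiv K E).symm Φ) = Φ φ := by
  have := (bidualEquiv K E).apply_symm_apply Φ
  exact LinearMap.congr_fun this φ

theorem ext_dual [IsWeaklyComplete K E] {x y : E} (h : ∀ φ : TopDual K E, φ x = φ y) : x = y :=
  (bidualEquiv K E).injective (LinearMap.ext h)

/-- A map into a weakly complete vector space is continuous as soon as its composites with all
continuous linear functionals are. -/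
theorem continuous_of_dual {X : Type*} [TopologicalSpace X] [h : IsWeaklyComplete K E] {f : X → E}
    (hf : ∀ φ : TopDual K E, Continuous fun x => φ (f x)) : Continuous f := by
  obtain ⟨J, ⟨e⟩⟩ := h.exists_equiv_pi
  rw [← e.comp_continuous_iff]
  exact continuous_pi fun j => hf (coord e j)

theorem continuousSMul_of_isWeaklyComplete [h : IsWeaklyComplete K E] : ContinuousSMul K E where
  continuous_smul := continuous_of_dual (K := K) fun φ => by
    simp only [map_smul, smul_eq_mul]
    exact continuous_fst.mul (φ.continuous.comp continuous_snd)

/-! ### Continuous bilinear forms -/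

variable (K E) in
/-- For `a : E`, the contraction `E' ⊗ X → X`, `φ ⊗ x ↦ φ(a) x`. -/
def contractLeft (X : Type*) [AddCommMonoid X] [Module K X] (a : E) :
    TopDual K E ⊗[K] X →ₗ[K] X :=
  (TensorProduct.lid K X).toLinearMap ∘ₗ (bidual K E a).rTensor X

@[simp] theorem contractLeft_tmul (X : Type*) [AddCommMonoid X] [Module K X] (a : E)
    (φ : TopDual K E) (x : X) : contractLeft K E X a (φ ⊗ₜ x) = φ a • x := by
  simp [contractLeft]

theorem ext_contractLeft {X : Type*} [AddCommMonoid X] [Module K X] [Module.Free K X] {z w : TopDual K E ⊗[K] X}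
    (h : ∀ a, contractLeft K E X a z = contractLeft K E X a w) : z = w := by
  classical
  let b := Module.Free.chooseBasis K X
  apply (TensorProduct.equivFinsuppOfBasisRight (M := TopDual K E) b).injective
  ext i a
  have key : ∀ t : TopDual K E ⊗[K] X,
      (TensorProduct.equivFinsuppOfBasisRight (M := TopDual K E) b t i) a =
        b.repr (contractLeft K E X a t) i := by
    intro t
    induction t with
    | zero => simp
    | tmul φ x =>
      rw [TensorProduct.equivFinsuppOfBasisRight_apply_tmul_apply]
      simp [mul_comm]
    | add t s ht hs => simp [ht, hs]
  rw [key, key, h]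

variable (K E F) in
/-- The bilinear form on `E × F` attached to an element of `E' ⊗ F'`:
`φ ⊗ ψ` gives `(x, y) ↦ φ(x) ψ(y)`. -/
def tensorForm : TopDual K E ⊗[K] TopDual K F →ₗ[K] E →ₗ[K] F →ₗ[K] K :=
  TensorProduct.lift
    (LinearMap.mk₂ K (fun φ ψ => (LinearMap.mul K K).compl₁₂ (φ : E →ₗ[K] K) (ψ : F →ₗ[K] K))
      (by intros; ext; simp) (by intros; ext; simp [mul_assoc])
      (by intros; ext; simp [mul_add]) (by intros; ext; simp [mul_left_comm]))

@[simp] theorem tensorForm_tmul (φ : TopDual K E) (ψ : TopDual K F) (x : E) (y : F) :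
    tensorForm K E F (φ ⊗ₜ ψ) x y = φ x * ψ y := rfl

theorem tensorForm_eq (z : TopDual K E ⊗[K] TopDual K F) (x : E) (y : F) :
    tensorForm K E F z x y = contractLeft K E (TopDual K F) x z y := by
  induction z with
  | zero => simp
  | tmul φ ψ => simp
  | add a b ha hb => simp [ha, hb]

theorem tensorForm_injective : Function.Injective (tensorForm K E F) := by
  intro z w h
  apply ext_contractLeft
  intro a
  ext y
  rw [← tensorForm_eq, ← tensorForm_eq, h]

theorem continuous_tensorForm_left (z : TopDual K E ⊗[K] TopDual K F) (y : F) :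
    Continuous fun x => tensorForm K E F z x y := by
  induction z with
  | zero => simpa using continuous_const
  | tmul φ ψ => exact φ.continuous.mul continuous_const
  | add a b ha hb => exact (ha.add hb).congr fun x => by simp

theorem continuous_tensorForm_right (z : TopDual K E ⊗[K] TopDual K F) (x : E) :
    Continuous fun y => tensorForm K E F z x y := by
  induction z with
  | zero => simpa using continuous_const
  | tmul φ ψ => exact continuous_const.mul ψ.continuous
  | add a b ha hb => exact (ha.add hb).congr fun y => by simp

/-- Every (jointly) continuous bilinear form on a product of weakly complete vector spaces comes
from `E' ⊗ F'`. -/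
theorem exists_tensorForm [hE : IsWeaklyComplete K E] [hF : IsWeaklyComplete K F]
    (b : E →ₗ[K] F →ₗ[K] K) (hb : Continuous fun p : E × F => b p.1 p.2) :
    ∃ z, tensorForm K E F z = b := by
  classical
  obtain ⟨I, ⟨e⟩⟩ := hE.exists_equiv_pi
  obtain ⟨J, ⟨f⟩⟩ := hF.exists_equiv_pi
  let u : I → E := fun i => e.symm (Pi.single i 1)
  let v : J → F := fun j => f.symm (Pi.single j 1)
  -- a basic neighbourhood of zero on which `b` is bounded
  obtain ⟨s, t, hst⟩ : ∃ (s : Finset I) (t : Finset J), ∀ x y, (∀ i ∈ s, e x i = 0) →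
      (∀ j ∈ t, f y j = 0) → b x y = 0 := by
    let B : (I → K) × (J → K) → K := fun p => b (e.symm p.1) (f.symm p.2)
    have hB : Continuous B :=
      hb.comp ((e.symm.continuous.comp continuous_fst).prodMk
        (f.symm.continuous.comp continuous_snd))
    have h0 : B ⁻¹' Metric.ball 0 1 ∈ nhds ((0 : I → K), (0 : J → K)) :=
      hB.continuousAt.preimage_mem_nhds (by
        simpa [B] using Metric.ball_mem_nhds (0 : K) one_pos)
    rw [nhds_prod_eq, Filter.mem_prod_iff] at h0
    obtain ⟨P, hP, Q, hQ, hPQ⟩ := h0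
    rw [nhds_pi, Filter.mem_pi] at hP hQ
    obtain ⟨s, hs, p, hp, hpP⟩ := hP
    obtain ⟨t, ht, q, hq, hqQ⟩ := hQ
    refine ⟨hs.toFinset, ht.toFinset, fun x y hx hy => ?_⟩
    by_contra hne
    have hbd : ∀ c : K, ‖c * b x y‖ < 1 := by
      intro c
      have hm : ((c • e x, f y) : (I → K) × (J → K)) ∈ B ⁻¹' Metric.ball 0 1 := by
        apply hPQ
        refine ⟨hpP fun i hi => ?_, hqQ fun j hj => ?_⟩
        · have := hx i (hs.mem_toFinset.2 hi)
          simpa [this] using mem_of_mem_nhds (hp i)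
        · have := hy j (ht.mem_toFinset.2 hj)
          simpa [this] using mem_of_mem_nhds (hq j)
      simpa [B] using hm
    have := hbd (b x y)⁻¹
    rw [inv_mul_cancel₀ hne] at this
    simp at this
  have hbl : ∀ x, Continuous fun y => b x y := fun x =>
    hb.comp (continuous_const.prodMk continuous_id)
  have hbr : ∀ y, Continuous fun x => b x y := fun y =>
    hb.comp (continuous_id.prodMk continuous_const)
  let L : E → TopDual K F := fun x => ⟨b x, hbl x⟩
  let R : F → TopDual K E := fun y => ⟨b.flip y, hbr y⟩
  refine ⟨∑ i ∈ s, coord e i ⊗ₜ[K] L (u i) +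
    ∑ j ∈ t, (R (v j) - ∑ i ∈ s, b (u i) (v j) • coord e i) ⊗ₜ[K] coord f j, ?_⟩
  ext x y
  have hx := hst (x - ∑ i ∈ s, e x i • u i) (y - ∑ j ∈ t, f y j • v j)
    (by
      intro i hi
      simp [u, Finset.sum_apply, Pi.single_apply, hi])
    (by
      intro j hj
      simp [v, Finset.sum_apply, Pi.single_apply, hj])
  simp only [map_sub, map_sum, map_smul, LinearMap.sub_apply, LinearMap.sum_apply,
    LinearMap.smul_apply, smul_eq_mul] at hx
  simp only [map_add, map_sum, LinearMap.add_apply, LinearMap.sum_apply, tensorForm_tmul]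
  have e1 : ∀ i, coord e i x = e x i := fun _ => rfl
  have e2 : ∀ j, coord f j y = f y j := fun _ => rfl
  have e3 : ∀ i, L (u i) y = b (u i) y := fun _ => rfl
  have e4 : ∀ j, R (v j) x = b x (v j) := fun _ => rfl
  have e5 : ∀ j, (R (v j) - ∑ i ∈ s, b (u i) (v j) • coord e i) x =
      b x (v j) - ∑ i ∈ s, e x i * b (u i) (v j) := by
    intro j
    simp [e4, e1, mul_comm]
  simp only [e1, e2, e3, e5]
  have e6 : ∑ j ∈ t, (b x (v j) - ∑ i ∈ s, e x i * b (u i) (v j)) * f y j =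
      ∑ j ∈ t, f y j * (b x (v j) - ∑ i ∈ s, e x i * b (u i) (v j)) :=
    Finset.sum_congr rfl fun _ _ => mul_comm _ _
  rw [e6]
  linear_combination -hx

/-- The element of `E' ⊗ F'` representing a continuous bilinear form. -/
def ofForm [IsWeaklyComplete K E] [IsWeaklyComplete K F]
    (b : E →ₗ[K] F →ₗ[K] K) (hb : Continuous fun p : E × F => b p.1 p.2) :
    TopDual K E ⊗[K] TopDual K F :=
  (exists_tensorForm b hb).choose

@[simp] theorem tensorForm_ofForm [IsWeaklyComplete K E] [IsWeaklyComplete K F]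
    (b : E →ₗ[K] F →ₗ[K] K) (hb : Continuous fun p : E × F => b p.1 p.2) :
    tensorForm K E F (ofForm b hb) = b :=
  (exists_tensorForm b hb).choose_spec

theorem continuous_compr₂ {b : E →ₗ[K] F →ₗ[K] Z}
    (hb : Continuous fun p : E × F => b p.1 p.2) (ζ : TopDual K Z) :
    Continuous fun p : E × F => b.compr₂ (ζ : Z →ₗ[K] K) p.1 p.2 :=
  ζ.continuous.comp hb

variable (K) in
/-- A continuous bilinear map `b : E × F → Z` of weakly complete spaces, seen on the duals:
`Z' → E' ⊗ F'` sends `ζ` to the tensor representing the form `ζ ∘ b`. -/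
def dualOfBilin [IsWeaklyComplete K E] [IsWeaklyComplete K F]
    (b : E →ₗ[K] F →ₗ[K] Z) (hb : Continuous fun p : E × F => b p.1 p.2) :
    TopDual K Z →ₗ[K] TopDual K E ⊗[K] TopDual K F where
  toFun ζ := ofForm (b.compr₂ (ζ : Z →ₗ[K] K)) (continuous_compr₂ hb ζ)
  map_add' ζ ξ := by
    apply tensorForm_injective
    rw [map_add, tensorForm_ofForm, tensorForm_ofForm, tensorForm_ofForm]
    ext x y
    simp
  map_smul' c ζ := by
    apply tensorForm_injective
    rw [map_smul, tensorForm_ofForm, tensorForm_ofForm]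
    ext x y
    simp

@[simp] theorem tensorForm_dualOfBilin [IsWeaklyComplete K E] [IsWeaklyComplete K F]
    (b : E →ₗ[K] F →ₗ[K] Z) (hb : Continuous fun p : E × F => b p.1 p.2) (ζ : TopDual K Z)
    (x : E) (y : F) : tensorForm K E F (dualOfBilin K b hb ζ) x y = ζ (b x y) := by
  change tensorForm K E F (ofForm (b.compr₂ (ζ : Z →ₗ[K] K)) (continuous_compr₂ hb ζ)) x y = _
  rw [tensorForm_ofForm]
  rfl

end Duality

/-! ## The tensor product of weakly complete vector spaces -/

section Tensor

variable {E : Type u} {F : Type v} {G : Type w} {H : Type x} {Z : Type y} [AddCommGroup E] [Module K E] [TopologicalSpace E]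
  [AddCommGroup F] [Module K F] [TopologicalSpace F]
  [AddCommGroup G] [Module K G] [TopologicalSpace G]
  [AddCommGroup H] [Module K H] [TopologicalSpace H]
  [AddCommGroup Z] [Module K Z] [TopologicalSpace Z]

variable (K E F) in
/-- The tensor product `E ⊗_W F` of weakly complete vector spaces: the algebraic dual of
`E' ⊗ F'`, with the topology of pointwise convergence. (`WithConv` only announces that, for
algebras, the multiplication will be the convolution product.) -/
def WTensor : Type (max u v) := WithConv (TopDual K E ⊗[K] TopDual K F →ₗ[K] K)

namespace WTensor

instance : AddCommGroup (WTensor K E F) :=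
  inferInstanceAs (AddCommGroup (WithConv (TopDual K E ⊗[K] TopDual K F →ₗ[K] K)))

instance : Module K (WTensor K E F) :=
  inferInstanceAs (Module K (WithConv (TopDual K E ⊗[K] TopDual K F →ₗ[K] K)))

/-- The linear functional on `E' ⊗ F'` that an element of `E ⊗_W F` is. -/
def toDual (t : WTensor K E F) : TopDual K E ⊗[K] TopDual K F →ₗ[K] K :=
  WithConv.ofConv t

/-- The element of `E ⊗_W F` that a linear functional on `E' ⊗ F'` is. -/
def ofDual (f : TopDual K E ⊗[K] TopDual K F →ₗ[K] K) : WTensor K E F :=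
  WithConv.toConv f

@[simp] theorem toDual_ofDual (f : TopDual K E ⊗[K] TopDual K F →ₗ[K] K) :
    (ofDual f).toDual = f := rfl

@[simp] theorem toDual_add (t s : WTensor K E F) : (t + s).toDual = t.toDual + s.toDual := rfl

@[simp] theorem toDual_smul (c : K) (t : WTensor K E F) : (c • t).toDual = c • t.toDual := rfl

theorem ext {t s : WTensor K E F} (h : ∀ z, t.toDual z = s.toDual z) : t = s :=
  WithConv.ofConv_injective (LinearMap.ext h)

instance : TopologicalSpace (WTensor K E F) :=
  TopologicalSpace.induced (fun t z => t.toDual z) Pi.topologicalSpace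

theorem continuous_toDual (z : TopDual K E ⊗[K] TopDual K F) :
    Continuous fun t : WTensor K E F => t.toDual z :=
  (continuous_apply z).comp continuous_induced_dom

theorem continuous_iff {X : Type*} [TopologicalSpace X] {f : X → WTensor K E F} :
    Continuous f ↔ ∀ z, Continuous fun x => (f x).toDual z := by
  rw [continuous_induced_rng, continuous_pi_iff]
  rfl

variable (K E F) in
/-- The coordinates of `E ⊗_W F` with respect to a basis of `E' ⊗ F'`. -/
def basisEquiv : WTensor K E F ≃L[K]
    (Module.Basis.ofVectorSpaceIndex K (TopDual K E ⊗[K] TopDual K F) → K) where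
  toFun t := fun j => t.toDual (Module.Basis.ofVectorSpace K _ j)
  invFun f := ofDual ((Module.Basis.ofVectorSpace K _).constr K f)
  map_add' _ _ := rfl
  map_smul' _ _ := rfl
  left_inv t := by
    refine WithConv.ofConv_injective ?_
    refine (Module.Basis.ofVectorSpace K (TopDual K E ⊗[K] TopDual K F)).ext fun j => ?_
    exact (Module.Basis.ofVectorSpace K _).constr_basis K _ j
  right_inv f := by
    funext j
    exact (Module.Basis.ofVectorSpace K _).constr_basis K _ j
  continuous_toFun := continuous_pi fun j => continuous_toDual _
  continuous_invFun := by
    rw [continuous_iff]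
    intro z
    simp only [toDual_ofDual, Module.Basis.constr_apply]
    exact continuous_finsetSum _ fun j _ => continuous_const.mul (continuous_apply j)

instance : IsWeaklyComplete K (WTensor K E F) :=
  ⟨⟨_, ⟨basisEquiv K E F⟩⟩⟩

/-- The elementary tensor `x ⊗ y`: the functional `φ ⊗ ψ ↦ φ(x) ψ(y)`. -/
def tmul (x : E) (y : F) : WTensor K E F :=
  ofDual (LinearMap.mul' K K ∘ₗ TensorProduct.map (bidual K E x) (bidual K F y))

@[simp] theorem toDual_tmul (x : E) (y : F) (φ : TopDual K E) (ψ : TopDual K F) :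
    (tmul x y : WTensor K E F).toDual (φ ⊗ₜ ψ) = φ x * ψ y := rfl

theorem toDual_tmul_eq (x : E) (y : F) (z : TopDual K E ⊗[K] TopDual K F) :
    (tmul x y : WTensor K E F).toDual z = tensorForm K E F z x y := by
  induction z with
  | zero => simp
  | tmul φ ψ => simp
  | add a b ha hb => simp [ha, hb]

theorem add_tmul (x x' : E) (y : F) :
    (tmul (x + x') y : WTensor K E F) = tmul x y + tmul x' y :=
  ext fun z => by simp [toDual_tmul_eq]

theorem tmul_add (x : E) (y y' : F) :
    (tmul x (y + y') : WTensor K E F) = tmul x y + tmul x y' :=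
  ext fun z => by simp [toDual_tmul_eq]

theorem sub_tmul (x x' : E) (y : F) :
    (tmul (x - x') y : WTensor K E F) = tmul x y - tmul x' y :=
  eq_sub_of_add_eq (by rw [← add_tmul, sub_add_cancel])

theorem tmul_sub (x : E) (y y' : F) :
    (tmul x (y - y') : WTensor K E F) = tmul x y - tmul x y' :=
  eq_sub_of_add_eq (by rw [← tmul_add, sub_add_cancel])

theorem smul_tmul (c : K) (x : E) (y : F) :
    (tmul (c • x) y : WTensor K E F) = c • tmul x y :=
  ext fun z => by simp [toDual_tmul_eq]

theorem tmul_smul (c : K) (x : E) (y : F) :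
    (tmul x (c • y) : WTensor K E F) = c • tmul x y :=
  ext fun z => by simp [toDual_tmul_eq]

/-- The functional `φ ↦ φ ∘ f` dual to a continuous linear map `f`. -/
def dualMap (f : E →L[K] G) : TopDual K G →ₗ[K] TopDual K E where
  toFun φ := φ.comp f
  map_add' _ _ := rfl
  map_smul' _ _ := rfl

@[simp] theorem dualMap_apply (f : E →L[K] G) (φ : TopDual K G) : dualMap f φ = φ.comp f := rfl

/-- The tensor product `f ⊗_W g` of two continuous linear maps. -/
def map (f : E →L[K] G) (g : F →L[K] H) : WTensor K E F →L[K] WTensor K G H where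
  toFun t := ofDual (t.toDual ∘ₗ TensorProduct.map (dualMap f) (dualMap g))
  map_add' _ _ := rfl
  map_smul' _ _ := rfl
  cont := continuous_iff.2 fun _ => continuous_toDual _

theorem toDual_map (f : E →L[K] G) (g : F →L[K] H) (t : WTensor K E F)
    (z : TopDual K G ⊗[K] TopDual K H) :
    (map f g t).toDual z = t.toDual (TensorProduct.map (dualMap f) (dualMap g) z) := rfl

theorem map_tmul (f : E →L[K] G) (g : F →L[K] H) (x : E) (y : F) :
    map f g (tmul x y) = tmul (f x) (g y) := by
  apply ext
  intro z
  induction z with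
  | zero => simp
  | tmul φ ψ => rfl
  | add a b ha hb => simp only [_root_.map_add, ha, hb]

/-- The morphism `E ⊗_W F → Z` induced by a continuous bilinear map `b : E × F → Z`. -/
def lift [IsWeaklyComplete K E] [IsWeaklyComplete K F] [IsWeaklyComplete K Z]
    (b : E →ₗ[K] F →ₗ[K] Z) (hb : Continuous fun p : E × F => b p.1 p.2) :
    WTensor K E F →L[K] Z where
  toFun t := (bidualEquiv K Z).symm (t.toDual ∘ₗ dualOfBilin K b hb)
  map_add' t s := by
    rw [← _root_.map_add]
    rfl
  map_smul' c t := by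
    rw [RingHom.id_apply, ← _root_.map_smul]
    rfl
  cont := continuous_of_dual (K := K) fun ζ => by
    simpa using continuous_toDual _

theorem lift_tmul [IsWeaklyComplete K E] [IsWeaklyComplete K F] [IsWeaklyComplete K Z]
    (b : E →ₗ[K] F →ₗ[K] Z) (hb : Continuous fun p : E × F => b p.1 p.2) (x : E) (y : F) :
    lift b hb (tmul x y) = b x y := by
  apply ext_dual (K := K)
  intro ζ
  simp [lift, toDual_tmul_eq]

variable (K E F) in
/-- Evaluation identifies `E' ⊗ F'` with the topological dual of `E ⊗_W F`. -/
def evalDual : TopDual K E ⊗[K] TopDual K F →ₗ[K] TopDual K (WTensor K E F) where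
  toFun z :=
    { toFun := fun t => t.toDual z
      map_add' := fun _ _ => rfl
      map_smul' := fun _ _ => rfl
      cont := continuous_toDual z }
  map_add' z w := ContinuousLinearMap.ext fun t => t.toDual.map_add z w
  map_smul' c z := ContinuousLinearMap.ext fun t => t.toDual.map_smul c z

@[simp] theorem evalDual_apply (z : TopDual K E ⊗[K] TopDual K F) (t : WTensor K E F) :
    evalDual K E F z t = t.toDual z := rfl

theorem evalDual_bijective : Function.Bijective (evalDual K E F) := by
  constructor
  · intro z w h
    rw [← sub_eq_zero, ← Module.forall_dual_apply_eq_zero_iff K]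
    intro f
    rw [_root_.map_sub, sub_eq_zero]
    exact DFunLike.congr_fun h (ofDual f)
  · intro Φ
    have h := mem_span_coord (basisEquiv K E F) Φ
    have hle : Submodule.span K (Set.range (coord (basisEquiv K E F))) ≤
        LinearMap.range (evalDual K E F) := by
      rw [Submodule.span_le]
      rintro _ ⟨j, rfl⟩
      exact ⟨Module.Basis.ofVectorSpace K _ j, rfl⟩
    exact hle h

variable (K E F) in
/-- The isomorphism `E' ⊗ F' ≅ (E ⊗_W F)'`. -/
def evalDualEquiv : TopDual K E ⊗[K] TopDual K F ≃ₗ[K] TopDual K (WTensor K E F) :=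
  LinearEquiv.ofBijective (evalDual K E F) evalDual_bijective

variable (K E F G) in
/-- The isomorphism of duals `E' ⊗ (F ⊗_W G)' ≅ E' ⊗ (F' ⊗ G') ≅ (E' ⊗ F') ⊗ G' ≅
(E ⊗_W F)' ⊗ G'`. -/
def assocDual : TopDual K E ⊗[K] TopDual K (WTensor K F G) ≃ₗ[K]
    TopDual K (WTensor K E F) ⊗[K] TopDual K G :=
  ((evalDualEquiv K F G).symm.lTensor (TopDual K E)).trans <|
    (TensorProduct.assoc K (TopDual K E) (TopDual K F) (TopDual K G)).symm.trans <|
      (evalDualEquiv K E F).rTensor (TopDual K G)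

variable (K E F G) in
/-- The associativity morphism `(E ⊗_W F) ⊗_W G → E ⊗_W (F ⊗_W G)`. -/
def assoc : WTensor K (WTensor K E F) G →L[K] WTensor K E (WTensor K F G) where
  toFun t := ofDual (t.toDual ∘ₗ (assocDual K E F G).toLinearMap)
  map_add' _ _ := rfl
  map_smul' _ _ := rfl
  cont := continuous_iff.2 fun _ => continuous_toDual _

theorem assoc_tmul (x : E) (y : F) (z : G) :
    assoc K E F G (tmul (tmul x y) z) = tmul x (tmul y z) := by
  have key : ∀ (φ : TopDual K E) (w : TopDual K F ⊗[K] TopDual K G),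
      (tmul (tmul x y) z : WTensor K (WTensor K E F) G).toDual
        (TensorProduct.map (evalDual K E F) LinearMap.id
          ((TensorProduct.assoc K _ _ _).symm (φ ⊗ₜ[K] w))) =
        φ x * (tmul y z : WTensor K F G).toDual w := by
    intro φ w
    induction w with
    | zero => simp
    | tmul ψ χ => simp [mul_assoc]
    | add a b ha hb => simp only [TensorProduct.tmul_add, _root_.map_add, ha, hb, mul_add]
  apply ext
  intro w
  induction w with
  | zero => simp
  | tmul φ Ω =>
    have := key φ ((evalDualEquiv K F G).symm Ω)
    have h2 : (tmul y z : WTensor K F G).toDual ((evalDualEquiv K F G).symm Ω) =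
        Ω (tmul y z) :=
      DFunLike.congr_fun ((evalDualEquiv K F G).apply_symm_apply Ω) (tmul y z)
    rw [h2] at this
    exact this
  | add a b ha hb => simp only [_root_.map_add, ha, hb]

variable (K) in
theorem mem_span_proj {I : Type u} (α : TopDual K (I → K)) :
    α ∈ Submodule.span K (Set.range fun i =>
      (ContinuousLinearMap.proj i : TopDual K (I → K))) :=
  mem_span_coord (ContinuousLinearEquiv.refl K (I → K)) α

variable (K) in
/-- The identification `K ^ (I × J) ≅ K ^ I ⊗_W K ^ J`. The function `θ` corresponds to the
functional `α ⊗ β ↦ α (i ↦ β (j ↦ θ(i, j)))`; conversely the `(i, j)`-th coordinate of a tensor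
is its value at `pr_i ⊗ pr_j`. -/
def powEquiv (I : Type u) (J : Type v) : (I × J → K) ≃L[K] WTensor K (I → K) (J → K) where
  toFun θ := ofDual <| TensorProduct.lift <| LinearMap.mk₂ K
    (fun (α : TopDual K (I → K)) (β : TopDual K (J → K)) => α fun i => β fun j => θ (i, j))
    (fun _ _ _ => rfl) (fun _ _ _ => rfl)
    (fun α β β' => α.map_add (fun i => β fun j => θ (i, j)) (fun i => β' fun j => θ (i, j)))
    (fun c α β => α.map_smul c (fun i => β fun j => θ (i, j)))
  invFun t := fun p => t.toDual (ContinuousLinearMap.proj p.1 ⊗ₜ ContinuousLinearMap.proj p.2)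
  map_add' θ θ' := by
    refine WithConv.ofConv_injective (TensorProduct.ext' fun α β => ?_)
    have h : ∀ i, (β fun j => (θ + θ') (i, j)) = (β fun j => θ (i, j)) + β fun j => θ' (i, j) :=
      fun i => β.map_add (fun j => θ (i, j)) (fun j => θ' (i, j))
    change (α fun i => β fun j => (θ + θ') (i, j)) =
      (α fun i => β fun j => θ (i, j)) + α fun i => β fun j => θ' (i, j)
    simp only [h]
    exact α.map_add _ _
  map_smul' c θ := by
    refine WithConv.ofConv_injective (TensorProduct.ext' fun α β => ?_)
    have h : ∀ i, (β fun j => (c • θ) (i, j)) = c • β fun j => θ (i, j) :=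
      fun i => β.map_smul c (fun j => θ (i, j))
    change (α fun i => β fun j => (c • θ) (i, j)) = c • (α fun i => β fun j => θ (i, j))
    simp only [h]
    exact α.map_smul c _
  left_inv θ := rfl
  right_inv t := by
    refine WithConv.ofConv_injective (TensorProduct.ext' fun α β => ?_)
    change (α fun i => β fun j => t.toDual
      (ContinuousLinearMap.proj i ⊗ₜ ContinuousLinearMap.proj j)) = t.toDual (α ⊗ₜ β)
    have hβ : ∀ (γ : TopDual K (I → K)) (β : TopDual K (J → K)),
        (β fun j => t.toDual (γ ⊗ₜ ContinuousLinearMap.proj j)) = t.toDual (γ ⊗ₜ β) := by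
      intro γ β
      induction mem_span_proj K β using Submodule.span_induction with
      | mem β h => obtain ⟨j, rfl⟩ := h; rfl
      | zero => simp
      | add a b _ _ ha hb => simp [ha, hb, TensorProduct.tmul_add]
      | smul c a _ ha => simp [ha]
    simp only [hβ]
    induction mem_span_proj K α using Submodule.span_induction with
    | mem β h => obtain ⟨j, rfl⟩ := h; rfl
    | zero => simp
    | add a b _ _ ha hb => simp [ha, hb, TensorProduct.add_tmul]
    | smul c a _ ha => simp [ha, ← TensorProduct.smul_tmul']
  continuous_toFun := continuous_iff.2 fun z => by
    induction z with
    | zero => exact continuous_const.congr fun θ => (map_zero _).symm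
    | tmul α β =>
      exact α.continuous.comp (continuous_pi fun i => β.continuous.comp
        (continuous_pi fun j => continuous_apply (i, j)))
    | add a b ha hb => exact (ha.add hb).congr fun θ => (_root_.map_add _ a b).symm
  continuous_invFun := continuous_pi fun p => continuous_toDual _

end WTensor

end Tensor

/-! ## Weakly complete algebras and their tensor product -/

section Algebra

variable {A : Type u} {B : Type v} [Ring A] [Algebra K A] [TopologicalSpace A] [IsTopologicalRing A]
  [IsWeaklyComplete K A] [Ring B] [Algebra K B] [TopologicalSpace B] [IsTopologicalRing B]
  [IsWeaklyComplete K B]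

variable (K A) in
/-- The map `A' → A' ⊗ A'` dual to the multiplication of `A`: if it sends `φ` to `∑ φᵢ ⊗ ψᵢ`, then
`φ (a b) = ∑ φᵢ(a) ψᵢ(b)`. -/
def dualMul : TopDual K A →ₗ[K] TopDual K A ⊗[K] TopDual K A :=
  dualOfBilin K (LinearMap.mul K A) continuous_mul

@[simp] theorem tensorForm_dualMul (φ : TopDual K A) (a b : A) :
    tensorForm K A A (dualMul K A φ) a b = φ (a * b) :=
  tensorForm_dualOfBilin _ _ _ _ _

variable (K A) in
/-- The map `A' → K` dual to the unit of `A`: evaluation at `1`. -/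
def dualOne : TopDual K A →ₗ[K] K := bidual K A 1

/-- Left translation of functionals, `φ ↦ φ(a ·)`. -/
def leftTrans (a : A) : TopDual K A →ₗ[K] TopDual K A where
  toFun φ := ⟨(φ : A →ₗ[K] K) ∘ₗ LinearMap.mulLeft K a,
    φ.continuous.comp (continuous_const.mul continuous_id)⟩
  map_add' _ _ := rfl
  map_smul' _ _ := rfl

@[simp] theorem leftTrans_apply (a : A) (φ : TopDual K A) (b : A) :
    leftTrans a φ b = φ (a * b) := rfl

theorem contractLeft_dualMul (φ : TopDual K A) (a : A) :
    contractLeft K A (TopDual K A) a (dualMul K A φ) = leftTrans a φ := by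
  ext b
  rw [← tensorForm_eq]
  simp

theorem rTensor_leftTrans_dualMul (φ : TopDual K A) (a : A) :
    (leftTrans a).rTensor (TopDual K A) (dualMul K A φ) = dualMul K A (leftTrans a φ) := by
  apply tensorForm_injective
  ext b c
  have : ∀ z : TopDual K A ⊗[K] TopDual K A,
      tensorForm K A A ((leftTrans a).rTensor (TopDual K A) z) b c =
        tensorForm K A A z (a * b) c := by
    intro z
    induction z with
    | zero => simp
    | tmul φ ψ => simp
    | add x y hx hy => simp only [map_add, LinearMap.add_apply, hx, hy]
  rw [this]
  simp [mul_assoc]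

theorem dualMul_coassoc (φ : TopDual K A) :
    TensorProduct.assoc K _ _ _ ((dualMul K A).rTensor _ (dualMul K A φ)) =
      (dualMul K A).lTensor (TopDual K A) (dualMul K A φ) := by
  apply ext_contractLeft
  intro a
  have h1 : ∀ z : TopDual K A ⊗[K] TopDual K A,
      contractLeft K A _ a ((TensorProduct.assoc K _ _ _) ((dualMul K A).rTensor _ z)) =
        (leftTrans a).rTensor _ z := by
    intro z
    induction z with
    | zero => simp
    | tmul φ ψ =>
      have h3 : ∀ w : TopDual K A ⊗[K] TopDual K A,
          contractLeft K A _ a ((TensorProduct.assoc K _ _ _) (w ⊗ₜ[K] ψ)) =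
            contractLeft K A _ a w ⊗ₜ ψ := by
        intro w
        induction w with
        | zero => simp
        | tmul α β => simp [TensorProduct.smul_tmul']
        | add x y hx hy => simp only [TensorProduct.add_tmul, map_add, hx, hy]
      simp [h3, contractLeft_dualMul]
    | add x y hx hy => simp only [map_add, hx, hy]
  have h2 : ∀ z : TopDual K A ⊗[K] TopDual K A,
      contractLeft K A _ a ((dualMul K A).lTensor _ z) =
        dualMul K A (contractLeft K A _ a z) := by
    intro z
    induction z with
    | zero => simp
    | tmul φ ψ => simp
    | add x y hx hy => simp only [map_add, hx, hy]
  rw [h1, h2, contractLeft_dualMul, rTensor_leftTrans_dualMul]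

/-- The topological dual of a weakly complete unital algebra is a coalgebra. -/
instance dualCoalgebra : Coalgebra K (TopDual K A) where
  comul := dualMul K A
  counit := dualOne K A
  coassoc := LinearMap.ext dualMul_coassoc
  rTensor_counit_comp_comul := by
    ext1 φ
    apply (TensorProduct.lid K (TopDual K A)).injective
    have := contractLeft_dualMul φ (1 : A)
    change contractLeft K A (TopDual K A) 1 (dualMul K A φ) = (1 : K) • φ
    rw [this]
    ext b
    simp
  lTensor_counit_comp_comul := by
    ext1 φ
    apply (TensorProduct.rid K (TopDual K A)).injective
    have : ∀ z : TopDual K A ⊗[K] TopDual K A, ∀ b,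
        (TensorProduct.rid K (TopDual K A) ((dualOne K A).lTensor _ z)) b =
          tensorForm K A A z b 1 := by
      intro z b
      induction z with
      | zero => simp
      | tmul φ ψ => simp [dualOne, mul_comm]
      | add x y hx hy =>
        simp only [map_add, LinearMap.add_apply, add_apply, hx, hy]
    ext b
    change (TensorProduct.rid K (TopDual K A) ((dualOne K A).lTensor _ (dualMul K A φ))) b =
      ((1 : K) • φ) b
    rw [this]
    simp

namespace WTensor

/-- The ring structure of `A ⊗_W B`: the multiplication dual to the comultiplication of
`A' ⊗ B'`. It satisfies `(a ⊗ b) (c ⊗ d) = ac ⊗ bd`, see `tmul_mul_tmul`. -/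
instance : Ring (WTensor K A B) where
  __ := (inferInstance : AddCommGroup (WTensor K A B))
  mul t s := ofDual (LinearMap.mul' K K ∘ₗ TensorProduct.map t.toDual s.toDual ∘ₗ Coalgebra.comul)
  one := ofDual Coalgebra.counit
  mul_assoc t s r :=
    mul_assoc (G := WithConv (TopDual K A ⊗[K] TopDual K B →ₗ[K] K)) t s r
  one_mul t := one_mul (M := WithConv (TopDual K A ⊗[K] TopDual K B →ₗ[K] K)) t
  mul_one t := mul_one (M := WithConv (TopDual K A ⊗[K] TopDual K B →ₗ[K] K)) t
  zero_mul t := zero_mul (M₀ := WithConv (TopDual K A ⊗[K] TopDual K B →ₗ[K] K)) t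
  mul_zero t := mul_zero (M₀ := WithConv (TopDual K A ⊗[K] TopDual K B →ₗ[K] K)) t
  left_distrib t s r :=
    left_distrib (R := WithConv (TopDual K A ⊗[K] TopDual K B →ₗ[K] K)) t s r
  right_distrib t s r :=
    right_distrib (R := WithConv (TopDual K A ⊗[K] TopDual K B →ₗ[K] K)) t s r

instance : Algebra K (WTensor K A B) :=
  Algebra.ofModule
    (fun c t s => smul_mul_assoc (β := WithConv (TopDual K A ⊗[K] TopDual K B →ₗ[K] K)) c t s)
    (fun c t s => mul_smul_comm (β := WithConv (TopDual K A ⊗[K] TopDual K B →ₗ[K] K)) c t s)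

theorem toDual_mul (t s : WTensor K A B) (z : TopDual K A ⊗[K] TopDual K B) :
    (t * s).toDual z =
      LinearMap.mul' K K (TensorProduct.map t.toDual s.toDual (Coalgebra.comul z)) := rfl

instance : IsTopologicalRing (WTensor K A B) where
  continuous_add := continuous_iff.2 fun z =>
    ((continuous_toDual z).comp continuous_fst).add ((continuous_toDual z).comp continuous_snd)
  continuous_neg := continuous_iff.2 fun z => (continuous_toDual z).neg
  continuous_mul := continuous_iff.2 fun z => by
    simp only [toDual_mul]
    induction (Coalgebra.comul (R := K) z) with
    | zero => simpa using continuous_const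
    | tmul a b =>
      exact ((continuous_toDual a).comp continuous_fst).mul
        ((continuous_toDual b).comp continuous_snd)
    | add a b ha hb => exact (ha.add hb).congr fun p => by simp

theorem tmul_mul_tmul (a c : A) (b d : B) :
    (tmul a b * tmul c d : WTensor K A B) = tmul (a * c) (b * d) := by
  have key : ∀ (z : TopDual K A ⊗[K] TopDual K A) (w : TopDual K B ⊗[K] TopDual K B),
      LinearMap.mul' K K (TensorProduct.map (tmul a b : WTensor K A B).toDual
        (tmul c d : WTensor K A B).toDual
        (TensorProduct.tensorTensorTensorComm K _ _ _ _ (z ⊗ₜ[K] w))) =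
      tensorForm K A A z a c * tensorForm K B B w b d := by
    intro z w
    induction z with
    | zero => simp
    | tmul φ φ' =>
      induction w with
      | zero => simp
      | tmul ψ ψ' => simp; ring
      | add x y hx hy => simp only [TensorProduct.tmul_add, _root_.map_add, LinearMap.add_apply,
          mul_add, hx, hy]
    | add x y hx hy => simp only [TensorProduct.add_tmul, _root_.map_add, LinearMap.add_apply,
          add_mul, hx, hy]
  refine WithConv.ofConv_injective (TensorProduct.ext' fun φ ψ => ?_)
  have h := key (dualMul K A φ) (dualMul K B ψ)
  simp only [tensorForm_dualMul] at h
  exact h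

theorem one_def : (1 : WTensor K A B) = tmul 1 1 := by
  refine WithConv.ofConv_injective (TensorProduct.ext' fun φ ψ => ?_)
  change (Coalgebra.counit (φ ⊗ₜ[K] ψ) : K) = φ 1 * ψ 1
  simp [mul_comm]
  rfl

end WTensor

/-! ## Symmetric Hopf algebras in the category of weakly complete spaces -/

variable (K A) in
/-- The multiplication of `A` as a morphism `A ⊗_W A → A`, `a ⊗ b ↦ a b`. -/
def mulMap : WTensor K A A →L[K] A :=
  WTensor.lift (LinearMap.mul K A) continuous_mul

variable (K A) in
/-- The canonical morphism `K ⊗_W A → A`, `s ⊗ a ↦ s a`. -/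
def leftUnitor : WTensor K K A →L[K] A :=
  WTensor.lift (LinearMap.lsmul K A) (by
    have := continuousSMul_of_isWeaklyComplete (K := K) (E := A)
    exact continuous_smul)

variable (K A) in
/-- The canonical morphism `A ⊗_W K → A`, `a ⊗ s ↦ s a`. -/
def rightUnitor : WTensor K A K →L[K] A :=
  WTensor.lift (LinearMap.lsmul K A).flip (by
    have := continuousSMul_of_isWeaklyComplete (K := K) (E := A)
    exact continuous_snd.smul continuous_fst)

variable (K A) in
/-- Comultiplication, coidentity and symmetry (antipode) on a weakly complete unital algebra. -/
structure HopfData where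
  comul : A →L[K] WTensor K A A
  counit : A →L[K] K
  antipode : A →L[K] A

/-- The axioms of a weakly complete symmetric Hopf algebra (group object in the monoidal category
of weakly complete vector spaces): comultiplication and coidentity are morphisms of algebras, and
the diagrams of coassociativity, coidentity and symmetry commute. -/
structure HopfData.IsSymmetricHopf (H : HopfData K A) : Prop where
  comul_one : H.comul 1 = 1
  comul_mul : ∀ a b, H.comul (a * b) = H.comul a * H.comul b
  counit_one : H.counit 1 = 1
  counit_mul : ∀ a b, H.counit (a * b) = H.counit a * H.counit b
  coassoc : ∀ a,
    WTensor.assoc K A A A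
        (WTensor.map H.comul (ContinuousLinearMap.id K A) (H.comul a)) =
      WTensor.map (ContinuousLinearMap.id K A) H.comul (H.comul a)
  counit_comul : ∀ a,
    leftUnitor K A (WTensor.map H.counit (ContinuousLinearMap.id K A) (H.comul a)) = a
  comul_counit : ∀ a,
    rightUnitor K A (WTensor.map (ContinuousLinearMap.id K A) H.counit (H.comul a)) = a
  antipode_mul : ∀ a,
    mulMap K A (WTensor.map H.antipode (ContinuousLinearMap.id K A) (H.comul a)) =
      algebraMap K A (H.counit a)
  mul_antipode : ∀ a,
    mulMap K A (WTensor.map (ContinuousLinearMap.id K A) H.antipode (H.comul a)) =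
      algebraMap K A (H.counit a)

/-- A morphism `A → B` of weakly complete unital algebras is a morphism of symmetric Hopf algebras
if it is compatible with comultiplications, coidentities and symmetries. -/
structure IsHopfMorphism (HA : HopfData K A) (HB : HopfData K B) (f : A →A[K] B) : Prop where
  map_comul : ∀ a, HB.comul (f a) =
    WTensor.map f.toContinuousLinearMap f.toContinuousLinearMap (HA.comul a)
  map_counit : ∀ a, HB.counit (f a) = HA.counit a
  map_antipode : ∀ a, HB.antipode (f a) = f (HA.antipode a)

end Algebra

/-! ### Semisimplicity and the radical -/

section Radical

variable {A : Type u} {B : Type v} [Ring A] [Algebra K A] [TopologicalSpace A]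
  [Ring B] [Algebra K B] [TopologicalSpace B]

variable (K A) in
/-- A weakly complete unital algebra is semisimple (over `K`) if the continuous unital algebra
morphisms `A → K` separate its points. (So the `ℝ`-algebra `ℂ` is not semisimple, the `ℂ`-algebra
`ℂ` is, and so are all powers `K ^ J`.) -/
def IsSemisimple : Prop := ∀ a : A, (∀ χ : A →A[K] K, χ a = 0) → a = 0

variable (K A) in
/-- The radical of a weakly complete unital algebra belonging to this notion of semisimplicity: the
set of elements annihilated by all continuous unital algebra morphisms `A → K`. -/
def radical : Ideal A := ⨅ χ : A →A[K] K, RingHom.ker χ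

theorem mem_radical {a : A} : a ∈ radical K A ↔ ∀ χ : A →A[K] K, χ a = 0 := by
  simp [radical, Submodule.mem_iInf, RingHom.mem_ker]

/-- Every morphism into a semisimple algebra vanishes on the radical. -/
theorem radical_le_ker (hB : IsSemisimple K B) (f : A →A[K] B) : radical K A ≤ RingHom.ker f :=
  fun a ha => hB (f a) fun χ => mem_radical.1 ha (χ.comp f)

end Radical

/-! ## The weakly complete enveloping algebra -/

section Enveloping

-- algebras carry the Lie bracket `⁅a, b⁆ = a * b - b * a`
attribute [local instance 100] LieRing.ofAssociativeRing

/-- The Lie algebra morphism `x ↦ f(x) ⊗ 1 + 1 ⊗ f(x)` from `g` to `A ⊗_W A`. -/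
def lieComul {g : Type u} [LieRing g] [LieAlgebra K g] {A : Type v} [Ring A] [Algebra K A]
    [TopologicalSpace A] [IsTopologicalRing A] [IsWeaklyComplete K A] (f : g →ₗ⁅K⁆ A) :
    g →ₗ⁅K⁆ WTensor K A A where
  toFun x := WTensor.tmul (f x) 1 + WTensor.tmul 1 (f x)
  map_add' x y := by
    simp only [map_add, WTensor.add_tmul, WTensor.tmul_add]
    abel
  map_smul' c x := by
    simp only [map_smul, WTensor.smul_tmul, WTensor.tmul_smul, smul_add, RingHom.id_apply]
  map_lie' {x y} := by
    simp only [LieHom.map_lie, LieRing.of_associative_ring_bracket, mul_add, add_mul,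
      WTensor.tmul_mul_tmul, one_mul, mul_one, WTensor.sub_tmul, WTensor.tmul_sub]
    abel

/-- The Lie algebra morphism `x ↦ -f(x)` from `g` to the opposite algebra of `A`. -/
def lieNegOp {g : Type u} [LieRing g] [LieAlgebra K g] {A : Type v} [Ring A] [Algebra K A]
    (f : g →ₗ⁅K⁆ A) : g →ₗ⁅K⁆ Aᵐᵒᵖ where
  toFun x := MulOpposite.op (-f x)
  map_add' x y := by
    apply MulOpposite.unop_injective
    simp [add_comm]
  map_smul' c x := by
    apply MulOpposite.unop_injective
    simp
  map_lie' {x y} := by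
    apply MulOpposite.unop_injective
    simp [LieRing.of_associative_ring_bracket]

variable (K) in
/-- A weakly complete enveloping algebra `U(g)` of a topological Lie algebra `g`: a weakly complete
unital algebra with a morphism `ι : g → U(g)` of topological Lie algebras (for the bracket
`ab - ba`), such that each morphism of topological Lie algebras from `g` to a weakly complete unital
algebra `A` factors uniquely as a morphism of weakly complete unital algebras `U(g) → A` after
`ι`. -/
structure EnvelopingAlgebra (g : Type u) [LieRing g] [LieAlgebra K g] [TopologicalSpace g] where
  carrier : Type u
  [ring : Ring carrier]
  [algebra : Algebra K carrier]
  [topologicalSpace : TopologicalSpace carrier]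
  [isTopologicalRing : IsTopologicalRing carrier]
  [isWeaklyComplete : IsWeaklyComplete K carrier]
  ι : g →ₗ⁅K⁆ carrier
  continuous_ι : Continuous ι
  existsUnique_lift : ∀ (A : Type u) [Ring A] [Algebra K A] [TopologicalSpace A]
    [IsTopologicalRing A] [IsWeaklyComplete K A] (f : g →ₗ⁅K⁆ A), Continuous f →
    ∃! F : carrier →A[K] A, ∀ x, F (ι x) = f x

attribute [instance] EnvelopingAlgebra.ring EnvelopingAlgebra.algebra
  EnvelopingAlgebra.topologicalSpace EnvelopingAlgebra.isTopologicalRing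
  EnvelopingAlgebra.isWeaklyComplete

namespace EnvelopingAlgebra

variable {g : Type u} [LieRing g] [LieAlgebra K g] [TopologicalSpace g]
  (U : EnvelopingAlgebra K g) {A : Type u} [Ring A] [Algebra K A] [TopologicalSpace A]
  [IsTopologicalRing A] [IsWeaklyComplete K A]

/-- The morphism `U(g) → A` extending a morphism `f : g → A` of topological Lie algebras. -/
def lift (f : g →ₗ⁅K⁆ A) (hf : Continuous f) : U.carrier →A[K] A :=
  (U.existsUnique_lift A f hf).exists.choose

theorem lift_ι (f : g →ₗ⁅K⁆ A) (hf : Continuous f) (x : g) : U.lift f hf (U.ι x) = f x :=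
  (U.existsUnique_lift A f hf).exists.choose_spec x

/-- The comultiplication `U(g) → U(g) ⊗_W U(g)` extending `x ↦ x ⊗ 1 + 1 ⊗ x`. -/
def comul : U.carrier →A[K] WTensor K U.carrier U.carrier :=
  U.lift (lieComul U.ι) (WTensor.continuous_iff.2 fun z => by
    have h : ∀ x, (lieComul U.ι x).toDual z =
        tensorForm K _ _ z (U.ι x) 1 + tensorForm K _ _ z 1 (U.ι x) := fun x => by
      rw [← WTensor.toDual_tmul_eq, ← WTensor.toDual_tmul_eq]
      rfl
    simp only [h]
    exact ((continuous_tensorForm_left z 1).comp U.continuous_ι).add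
      ((continuous_tensorForm_right z 1).comp U.continuous_ι))

/-- The coidentity `U(g) → K`, the morphism vanishing on `g`. -/
def counit : U.carrier →L[K] K :=
  (ContinuousLinearEquiv.ulift : ULift.{u} K ≃L[K] K).toContinuousLinearMap.comp
    (U.lift (0 : g →ₗ⁅K⁆ ULift.{u} K) continuous_const).toContinuousLinearMap

/-- The symmetry of `U(g)`, the anti-automorphism extending `x ↦ -x` on `g`. -/
def antipode : U.carrier →L[K] U.carrier :=
  ((MulOpposite.opContinuousLinearEquiv K).symm :
      U.carrierᵐᵒᵖ ≃L[K] U.carrier).toContinuousLinearMap.comp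
    (U.lift (lieNegOp U.ι)
      (MulOpposite.continuous_op.comp U.continuous_ι.neg)).toContinuousLinearMap

/-- The Hopf algebra structure of `U(g)`. -/
def hopf : HopfData K U.carrier where
  comul := U.comul.toContinuousLinearMap
  counit := U.counit
  antipode := U.antipode

end EnvelopingAlgebra

end Enveloping

/-! ## The algebra `V(g) = K ^ g'` -/

section Power

attribute [local instance 100] LieRing.ofAssociativeRing

variable (K) in
/-- The weakly complete algebra `V(g) = K ^ g'` with componentwise operations. -/
abbrev PowerAlgebra (g : Type u) [AddCommGroup g] [Module K g] [TopologicalSpace g] : Type u :=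
  TopDual K g → K

variable (K) in
/-- The Hopf algebra structure of `V(g) = K ^ g'`: `c(φ)(ω₁, ω₂) = φ(ω₁ + ω₂)`, under the
identification `V(g) ⊗_W V(g) = K ^ (g' × g')`; `k(φ) = φ(0)`; `σ(φ)(ω) = φ(-ω)`. -/
def powerHopf (g : Type u) [AddCommGroup g] [Module K g] [TopologicalSpace g] :
    HopfData K (PowerAlgebra K g) where
  comul := (WTensor.powEquiv K (TopDual K g) (TopDual K g)).toContinuousLinearMap.comp
    (ContinuousLinearMap.pi fun p : TopDual K g × TopDual K g =>
      ContinuousLinearMap.proj (p.1 + p.2))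
  counit := ContinuousLinearMap.proj 0
  antipode := ContinuousLinearMap.pi fun ω => ContinuousLinearMap.proj (-ω)

variable (K) in
/-- The inclusion `ν : g → V(g)`, `ν(x)(ω) = ω(x)`, for abelian `g`. -/
def powerι (g : Type u) [LieRing g] [LieAlgebra K g] [IsLieAbelian g] [TopologicalSpace g] :
    g →ₗ⁅K⁆ PowerAlgebra K g where
  toFun x := fun ω => ω x
  map_add' x y := by
    funext ω
    exact ω.map_add x y
  map_smul' c x := by
    funext ω
    exact ω.map_smul c x
  map_lie' {x y} := by
    funext ω
    simp [trivial_lie_zero, LieRing.of_associative_ring_bracket, mul_comm]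

/-- The canonical morphism `q : U(g) → V(g)` fixing `g`, for abelian `g`: the unique morphism of
weakly complete unital algebras with `q (ι x) = ν x`. -/
def EnvelopingAlgebra.toPower {g : Type u} [LieRing g] [LieAlgebra K g] [IsLieAbelian g]
    [TopologicalSpace g] (U : EnvelopingAlgebra K g) : U.carrier →A[K] PowerAlgebra K g :=
  U.lift (powerι K g) (continuous_pi fun ω => ω.continuous)

theorem EnvelopingAlgebra.toPower_ι {g : Type u} [LieRing g] [LieAlgebra K g] [IsLieAbelian g]
    [TopologicalSpace g] (U : EnvelopingAlgebra K g) (x : g) (ω : TopDual K g) :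
    U.toPower (U.ι x) ω = ω x :=
  congrFun (U.lift_ι (powerι K g) _ x) ω

end Power

end

end WeaklyComplete

/-! Everything rests on duality: a weakly complete space is the full algebraic dual of its
topological dual (`bidual_bijective`). Hence any linear functional on the dual, with no continuity
required, is an element of the space.

Existence. As `g` is abelian, its universal enveloping algebra `S` is commutative. Let `f : S → A`
be an algebra morphism that is continuous on `g`. For `φ ∈ A'` the form `φ(ab)` is a finite sum `∑
φₖ(a) ψₖ(b)`, so `φ ∘ f` has a finite-dimensional space of translates, and these are continuous on
`g`. Let `D` be the space of all functionals on `S` with both properties; `U(g)` is realized as its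
dual `D^*`. The product on `D^*` comes from identifying it with the operators on `D` that commute
with translations. On each single `φ` such an operator agrees with a translation, so the product is
commutative; a finite coproduct formula makes it jointly continuous. The transpose of `A' → D`
extends `f` to `D^*`, uniquely because `S` is dense.

Hopf axioms. In `V(g)` they are the group axioms of `(g', +)`, read coordinate by coordinate. In
`U(g)` each one equates two continuous algebra morphisms and is checked on `g`. Every enveloping
algebra is a retract of the constructed one, hence commutative, so multiplication and antipode are
algebra morphisms too.

The morphism `q`. Its coordinates are exactly the continuous characters of `U(g)`, which are
parametrized by `g'`; this gives the kernel. Distinct characters are linearly independent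
(Dedekind), so some functional on `U(g)'` takes prescribed values on them; by duality it is an
element of `U(g)`, whence surjectivity.

Jacobson radical. For a non-unit `a` some nonzero `φ` satisfies `φ(a ·) = 0`. The ideal `{b | φ(b ·)
= 0}` is proper, of finite codimension, and contains `a`. Over an algebraically closed field a
maximal ideal above it is the kernel of a continuous character. -/

namespace WeaklyComplete

noncomputable section

variable {K : Type} [RCLike K]

/-! ### Continuous functionals and density -/

/-- A space topologized as the weak dual of an abstract vector space is weakly complete. -/
theorem isWeaklyComplete_of_dual {E C : Type u} [AddCommGroup E] [Module K E] [TopologicalSpace E]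
    [AddCommGroup C] [Module K C] (e : E ≃ₗ[K] (C →ₗ[K] K))
    (he : Topology.IsInducing fun (x : E) (c : C) => e x c) : IsWeaklyComplete K E := by
  let b := Module.Basis.ofVectorSpace K C
  refine ⟨⟨_, ⟨{ (e.trans (b.constr K).symm : E ≃ₗ[K] _ → K) with
    continuous_toFun := ?_
    continuous_invFun := ?_ }⟩⟩⟩
  · exact continuous_pi fun j => (continuous_apply (b j)).comp he.continuous
  · rw [he.continuous_iff, continuous_pi_iff]
    intro c
    have h : ∀ f : Module.Basis.ofVectorSpaceIndex K C → K,
        e ((e.trans (b.constr K).symm).symm f) c = (b.constr K f) c := fun f => by simp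
    refine Continuous.congr ?_ fun f => (h f).symm
    -- For fixed `c` only finitely many basis coordinates of `c` are nonzero, so the value is a
    -- finite sum of coordinates of `f`.
    simp only [Module.Basis.constr_apply]
    exact continuous_finsetSum _ fun j _ => continuous_const.mul (continuous_apply j)

/-- The continuous functionals on the weak dual of `C` are the evaluations at elements of `C`. -/
theorem exists_eq_apply_of_dual {E C : Type u} [AddCommGroup E] [Module K E] [TopologicalSpace E]
    [AddCommGroup C] [Module K C] (e : E ≃ₗ[K] (C →ₗ[K] K))
    (he : Topology.IsInducing fun (x : E) (c : C) => e x c) (φ : TopDual K E) :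
    ∃ c, ∀ x, φ x = e x c := by
  have hw : IsWeaklyComplete K E := isWeaklyComplete_of_dual e he
  -- a functional on `E'` killing all evaluations is an evaluation, hence zero
  let ev : C →ₗ[K] TopDual K E :=
    { toFun := fun c =>
        { toFun := fun x => e x c
          map_add' := fun x y => by simp
          map_smul' := fun a x => by simp
          cont := (continuous_apply c).comp he.continuous }
      map_add' := fun c d => by ext x; exact (e x).map_add c d
      map_smul' := fun a c => by ext x; exact (e x).map_smul a c }
  suffices h : φ ∈ LinearMap.range ev by
    obtain ⟨c, rfl⟩ := h
    exact ⟨c, fun x => rfl⟩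
  by_contra hφ
  obtain ⟨Φ, hΦ, h0⟩ := Submodule.exists_le_ker_of_notMem hφ
  apply hΦ
  obtain ⟨x, rfl⟩ := (bidualEquiv K E).surjective Φ
  have hx : x = 0 := by
    apply e.injective
    ext c
    exact (h0 ⟨c, rfl⟩ : bidualEquiv K E x (ev c) = 0).trans (by simp)
  subst hx
  simp

/-! ### The continuous finite dual -/

section FiniteDual

variable {g : Type u} [AddCommGroup g] [Module K g] [TopologicalSpace g]
  {S : Type u} [CommRing S] [Algebra K S]

/-- The translates `s ↦ φ (s ·)` of a functional `φ`. -/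
def translates (φ : (S →ₗ[K] K)) : S →ₗ[K] (S →ₗ[K] K) :=
  (LinearMap.mul K S).compr₂ φ

@[simp] theorem translates_apply (φ : (S →ₗ[K] K)) (s t : S) :
    translates φ s t = φ (s * t) := rfl

/-- The functionals on `S` with a finite-dimensional space of translates, all of which are continuous
along `i : g → S`. -/
def finiteDual (i : g →ₗ[K] S) : Submodule K ((S →ₗ[K] K)) where
  carrier := {φ | FiniteDimensional K (LinearMap.range (translates φ)) ∧
    ∀ s, Continuous fun x => φ (s * i x)}
  add_mem' {φ ψ} hφ hψ := by
    have := hφ.1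
    have := hψ.1
    refine ⟨Submodule.finiteDimensional_of_le
      (S₂ := LinearMap.range (translates φ) ⊔ LinearMap.range (translates ψ)) ?_,
      fun s => (hφ.2 s).add (hψ.2 s)⟩
    rintro _ ⟨s, rfl⟩
    exact Submodule.add_mem_sup (LinearMap.mem_range_self _ s) (LinearMap.mem_range_self _ s)
  zero_mem' := by
    refine ⟨Submodule.finiteDimensional_of_le (S₂ := ⊥) ?_, fun s => continuous_const⟩
    rintro _ ⟨s, rfl⟩
    rfl
  smul_mem' c φ hφ := by
    have := hφ.1
    refine ⟨Submodule.finiteDimensional_of_le (S₂ := LinearMap.range (translates φ)) ?_,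
      fun s => continuous_const.mul (hφ.2 s)⟩
    rintro _ ⟨s, rfl⟩
    exact Submodule.smul_mem _ c (LinearMap.mem_range_self _ s)

/-- The continuous finite dual as a vector space. -/
def FiniteDual (i : g →ₗ[K] S) : Type u := finiteDual i

namespace FiniteDual

variable {i : g →ₗ[K] S}

instance : AddCommGroup (FiniteDual i) := inferInstanceAs (AddCommGroup (finiteDual i))

instance : Module K (FiniteDual i) := inferInstanceAs (Module K (finiteDual i))

/-- The functional on `S` that an element of the continuous finite dual is. -/
def val : FiniteDual i →ₗ[K] S →ₗ[K] K where
  toFun φ := Subtype.val φ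
  map_add' _ _ := rfl
  map_smul' _ _ := rfl

theorem val_injective : Function.Injective (val (i := i)) := Subtype.val_injective

theorem ext {φ ψ : FiniteDual i} (h : ∀ s, val φ s = val ψ s) : φ = ψ :=
  val_injective (LinearMap.ext h)

/-- An element of the continuous finite dual, from its underlying functional. -/
def mk (φ : S →ₗ[K] K) (hφ : φ ∈ finiteDual i) : FiniteDual i := ⟨φ, hφ⟩

@[simp] theorem val_mk (φ : S →ₗ[K] K) (hφ : φ ∈ finiteDual i) : val (mk φ hφ) = φ := rfl

theorem val_mem (φ : FiniteDual i) : val φ ∈ finiteDual i := Subtype.property φ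

theorem translates_mem (φ : FiniteDual i) (s : S) : translates (val φ) s ∈ finiteDual i := by
  have := φ.val_mem.1
  refine ⟨Submodule.finiteDimensional_of_le (S₂ := LinearMap.range (translates (val φ))) ?_,
    fun t => ?_⟩
  · rintro _ ⟨t, rfl⟩
    refine ⟨s * t, ?_⟩
    ext r
    simp [mul_assoc]
  · simpa [mul_assoc] using φ.val_mem.2 (s * t)

variable (i) in
/-- Translation `φ ↦ φ (s ·)` on the continuous finite dual. -/
def shift : S →ₐ[K] Module.End K (FiniteDual i) where
  toFun s :=
    { toFun := fun φ => mk (translates (val φ) s) (φ.translates_mem s)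
      map_add' := fun _ _ => ext fun t => by simp
      map_smul' := fun _ _ => ext fun t => by simp }
  map_one' := LinearMap.ext fun φ => ext fun t => by simp
  map_mul' s t := LinearMap.ext fun φ => ext fun r => by
    -- Composing translations reverses the order of the factors; commutativity of `S` restores it.
    change val φ (s * t * r) = val φ (t * (s * r))
    congr 1
    ring
  map_zero' := LinearMap.ext fun φ => ext fun t => by simp
  map_add' s t := LinearMap.ext fun φ => ext fun r => by
    change val φ ((s + t) * r) = val φ (s * r) + val φ (t * r)
    rw [add_mul, map_add]
  commutes' c := LinearMap.ext fun φ => ext fun r => by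
    simp [Algebra.algebraMap_eq_smul_one]

@[simp] theorem val_shift (s t : S) (φ : FiniteDual i) :
    val (shift i s φ) t = val φ (s * t) := rfl

/-- The map `s ↦ φ (s ·)` into the continuous finite dual. -/
def orbit (φ : FiniteDual i) : S →ₗ[K] FiniteDual i :=
  (shift i).toLinearMap.flip φ

@[simp] theorem orbit_apply (φ : FiniteDual i) (s : S) : orbit φ s = shift i s φ := rfl

instance finiteDimensional_range_orbit (φ : FiniteDual i) :
    FiniteDimensional K (LinearMap.range (orbit φ)) := by
  have := φ.val_mem.1
  have h : (LinearMap.range (orbit φ)).map val = LinearMap.range (translates (val φ)) := by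
    rw [← LinearMap.range_comp]
    rfl
  rw [FiniteDimensional, Module.Finite.iff_fg]
  apply Submodule.fg_of_fg_map_injective val val_injective
  rw [h]
  exact Module.Finite.iff_fg.1 this

/-- On the translates of `φ`, every functional is the evaluation at some point. -/
theorem exists_eval_shift (v : FiniteDual i →ₗ[K] K) (φ : FiniteDual i) :
    ∃ t, ∀ s, v (shift i s φ) = val φ (s * t) := by
  let B : LinearMap.range (orbit φ) →ₗ[K] S →ₗ[K] K := val ∘ₗ Submodule.subtype _
  have hB : Function.Injective B := val_injective.comp Subtype.val_injective
  -- The orbit of `φ` is finite-dimensional and embeds in the dual of `S`, so the points of `S`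
  -- induce every functional on it.
  obtain ⟨t, ht⟩ := LinearMap.flip_surjective_iff₁.2 hB (v ∘ₗ Submodule.subtype _)
  refine ⟨t, fun s => ?_⟩
  exact (LinearMap.congr_fun ht ⟨orbit φ s, s, rfl⟩).symm

/-- The coproduct of `φ`: `φ (s t) = ∑ φ (s tₖ) ψₖ (t)`. -/
theorem exists_translate_eq_sum (φ : FiniteDual i) :
    ∃ (n : ℕ) (t : Fin n → S) (ψ : Fin n → FiniteDual i),
      ∀ s, shift i s φ = ∑ k, val φ (s * t k) • ψ k := by
  let W := LinearMap.range (orbit φ)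
  let b := Module.finBasis K W
  have hc : ∀ k, ∃ v : FiniteDual i →ₗ[K] K, ∀ w : W, v w = b.coord k w := fun k => by
    obtain ⟨v, hv⟩ := LinearMap.exists_extend (b.coord k)
    exact ⟨v, fun w => LinearMap.congr_fun hv w⟩
  choose v hv using hc
  -- The `k`-th coordinate of a translate of `φ` is thus evaluation at a point `t k`, which gives
  -- the coefficients `φ (s tₖ)`.
  choose t ht using fun k => exists_eval_shift (v k) φ
  refine ⟨_, t, fun k => (b k).1, fun s => ?_⟩
  have h := congrArg Subtype.val (b.sum_repr ⟨orbit φ s, s, rfl⟩)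
  simp only [AddSubmonoidClass.coe_finsetSum, Submodule.coe_smul] at h
  refine Eq.trans h.symm (Finset.sum_congr rfl fun k _ => ?_)
  rw [← ht, ← b.coord_apply, ← hv]
  rfl

end FiniteDual

/-! ### The completion as a weakly complete algebra -/

open FiniteDual

variable {i : g →ₗ[K] S}

/-- The weakly complete completion of `S` determined by `i : g → S`: the dual of the continuous finite
dual, realized as the algebra of operators on it commuting with translations. -/
def Completion (i : g →ₗ[K] S) : Type u :=
  Subalgebra.centralizer K (Set.range (shift i))

namespace Completion

instance : Ring (Completion i) :=
  inferInstanceAs (Ring (Subalgebra.centralizer K (Set.range (shift i))))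

instance : Algebra K (Completion i) :=
  inferInstanceAs (Algebra K (Subalgebra.centralizer K (Set.range (shift i))))

/-- The operator on the continuous finite dual that an element of the completion is. -/
def op (i : g →ₗ[K] S) : Completion i →ₐ[K] Module.End K (FiniteDual i) :=
  Subalgebra.val _

theorem op_injective : Function.Injective (op i) := Subtype.val_injective

theorem op_translate (T : Completion i) (s : S) (φ : FiniteDual i) :
    op i T (shift i s φ) = shift i s (op i T φ) :=
  (LinearMap.congr_fun ((Subalgebra.mem_centralizer_iff K).1 T.2 _ ⟨s, rfl⟩) φ).symm

/-- Evaluation at `s` is evaluation at `1` after translating by `s`, and `T` commutes with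
translations. So `T` is recovered from the single functional `φ ↦ (T φ)(1)`. -/
theorem op_apply (T : Completion i) (φ : FiniteDual i) (s : S) :
    val (op i T φ) s = val (op i T (shift i s φ)) 1 := by
  simp [op_translate]

/-- The functional on the continuous finite dual that an element of the completion is. -/
def toDual (i : g →ₗ[K] S) : Completion i →ₗ[K] (FiniteDual i →ₗ[K] K) where
  toFun T :=
    { toFun := fun φ => val (op i T φ) 1
      map_add' := fun _ _ => by simp
      map_smul' := fun _ _ => by simp }
  map_add' _ _ := by ext; simp
  map_smul' _ _ := by ext; simp

theorem toDual_apply (T : Completion i) (φ : FiniteDual i) :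
    toDual i T φ = val (op i T φ) 1 := rfl

theorem op_eq (T : Completion i) (φ : FiniteDual i) (s : S) :
    val (op i T φ) s = toDual i T (shift i s φ) := op_apply T φ s

/-- By `exists_eval_shift` the functional of `T` is a point evaluation on the orbit of `φ`. The
point `t` depends on `φ`: the operator is a translation only locally. -/
theorem exists_op_eq_translate (T : Completion i) (φ : FiniteDual i) :
    ∃ t, op i T φ = shift i t φ := by
  obtain ⟨t, ht⟩ := exists_eval_shift (toDual i T) φ
  refine ⟨t, FiniteDual.ext fun s => ?_⟩
  rw [op_eq, ht, val_shift, mul_comm]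

/-- On a given `φ` both operators act as translations, by `t` and `t'`. Since each commutes with
translations, both products send `φ` to its translate by `t t'`. -/
theorem mul_comm (T T' : Completion i) : T * T' = T' * T := by
  apply op_injective
  rw [map_mul, map_mul]
  refine LinearMap.ext fun φ => ?_
  obtain ⟨t, ht⟩ := exists_op_eq_translate T φ
  obtain ⟨t', ht'⟩ := exists_op_eq_translate T' φ
  rw [Module.End.mul_apply, Module.End.mul_apply, ht, ht', op_translate, op_translate, ht, ht',
    ← Module.End.mul_apply, ← Module.End.mul_apply, ← map_mul, ← map_mul, _root_.mul_comm]

/-- The element of the completion given by a functional on the continuous finite dual. -/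
def ofDual (v : (FiniteDual i →ₗ[K] K)) : Completion i where
  val :=
    { toFun := fun φ => mk (v ∘ₗ orbit φ) (by
        -- The functional `s ↦ v (s φ)` is itself a translate of `φ`, hence again in the continuous
        -- finite dual.
        obtain ⟨t, ht⟩ := exists_eval_shift v φ
        convert val_mem (shift i t φ)
        ext s
        exact (ht s).trans (by simp [_root_.mul_comm]))
      map_add' := fun _ _ => FiniteDual.ext fun _ => by simp
      map_smul' := fun _ _ => FiniteDual.ext fun _ => by simp }
  property := by
    rw [Subalgebra.mem_centralizer_iff]
    rintro _ ⟨s, rfl⟩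
    refine LinearMap.ext fun φ => FiniteDual.ext fun t => ?_
    change v (shift i (s * t) φ) = v (shift i t (shift i s φ))
    rw [← Module.End.mul_apply, ← map_mul, _root_.mul_comm]

/-- The completion is the dual of the continuous finite dual. -/
def dualEquiv (i : g →ₗ[K] S) : Completion i ≃ₗ[K] (FiniteDual i →ₗ[K] K) :=
  { toDual i with
    invFun := ofDual
    left_inv := fun T => by
      apply op_injective
      exact LinearMap.ext fun φ => FiniteDual.ext fun s => (op_eq T φ s).symm
    right_inv := fun v => by
      ext φ
      change v (shift i 1 φ) = v φ
      simp }

instance : TopologicalSpace (Completion i) :=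
  TopologicalSpace.induced (fun T φ => dualEquiv i T φ) Pi.topologicalSpace

theorem isInducing_dualEquiv :
    Topology.IsInducing fun (T : Completion i) φ => dualEquiv i T φ := ⟨rfl⟩

instance : IsWeaklyComplete K (Completion i) :=
  isWeaklyComplete_of_dual (dualEquiv i) isInducing_dualEquiv

theorem continuous_toDual (φ : FiniteDual i) : Continuous fun T => toDual i T φ :=
  (continuous_apply φ).comp isInducing_dualEquiv.continuous

theorem continuous_iff {X : Type*} [TopologicalSpace X] {f : X → Completion i} :
    Continuous f ↔ ∀ φ, Continuous fun x => toDual i (f x) φ := by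
  rw [isInducing_dualEquiv.continuous_iff, continuous_pi_iff]
  rfl

instance : IsTopologicalRing (Completion i) where
  continuous_add := continuous_iff.2 fun φ => by
    simp only [map_add, LinearMap.add_apply]
    exact ((continuous_toDual φ).comp continuous_fst).add
      ((continuous_toDual φ).comp continuous_snd)
  continuous_neg := continuous_iff.2 fun φ => by
    simp only [map_neg, LinearMap.neg_apply]
    exact (continuous_toDual φ).neg
  continuous_mul := continuous_iff.2 fun φ => by
    obtain ⟨n, t, ψ, h⟩ := exists_translate_eq_sum φ
    have key : ∀ p : Completion i × Completion i, toDual i (p.1 * p.2) φ =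
        ∑ k, toDual i p.2 (ψ k) * toDual i p.1 (shift i (t k) φ) := by
      intro p
      -- Applying the second factor to the coproduct formula writes its value at `φ` through fixed
      -- translates of `φ`. Each evaluation of a product is then a finite polynomial in evaluations
      -- of the factors.
      have h2 : op i p.2 φ = ∑ k, toDual i p.2 (ψ k) • shift i (t k) φ := by
        refine FiniteDual.ext fun s => ?_
        rw [op_eq, h]
        simp [LinearMap.sum_apply, _root_.mul_comm]
      rw [toDual_apply, map_mul, Module.End.mul_apply, h2, ← toDual_apply]
      simp
    simp only [key]
    exact continuous_finsetSum _ fun k _ => ((continuous_toDual _).comp continuous_snd).mul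
      ((continuous_toDual _).comp continuous_fst)

/-- The canonical map of `S` to its completion. -/
def of (i : g →ₗ[K] S) : S →ₐ[K] Completion i :=
  (shift i).codRestrict _ fun s => by
    rw [Subalgebra.mem_centralizer_iff]
    rintro _ ⟨t, rfl⟩
    rw [← map_mul, ← map_mul, _root_.mul_comm]

@[simp] theorem op_of (s : S) : op i (of i s) = shift i s := rfl

@[simp] theorem toDual_of (s : S) (φ : FiniteDual i) : toDual i (of i s) φ = val φ s := by
  simp [toDual_apply]

theorem continuous_of_comp : Continuous fun x => of i (i x) :=
  continuous_iff.2 fun φ => by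
    simpa using φ.val_mem.2 1

/-- The image of `S` is dense in its completion. -/
theorem ext_of {Z : Type v} [AddCommGroup Z] [Module K Z] [TopologicalSpace Z] [IsWeaklyComplete K Z]
    {f f' : Completion i →L[K] Z} (h : ∀ s, f (of i s) = f' (of i s)) : f = f' := by
  ext T
  apply ext_dual (K := K)
  intro ζ
  -- Continuous functionals on the completion are elements of the continuous finite dual, and those
  -- are functions on `S`; agreement on `S` therefore makes them equal.
  obtain ⟨c, hc⟩ := exists_eq_apply_of_dual (dualEquiv i) isInducing_dualEquiv (ζ.comp f)
  obtain ⟨c', hc'⟩ := exists_eq_apply_of_dual (dualEquiv i) isInducing_dualEquiv (ζ.comp f')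
  suffices hcc : c = c' by
    have h1 := hc T
    have h2 := hc' T
    rw [hcc] at h1
    exact h1.trans h2.symm
  refine FiniteDual.ext fun s => ?_
  have h1 : ζ (f (of i s)) = val c s := (hc (of i s)).trans (toDual_of s c)
  have h2 : ζ (f' (of i s)) = val c' s := (hc' (of i s)).trans (toDual_of s c')
  rw [← h1, h, h2]

/-! ### Extension of algebra morphisms to the completion -/

section Lift

variable {A : Type v} [Ring A] [Algebra K A] [TopologicalSpace A] [IsTopologicalRing A]
  [IsWeaklyComplete K A] (f : S →ₐ[K] A) (hf : Continuous fun x => f (i x))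

/-- Pulling back continuous functionals along an algebra morphism gives elements of the continuous
finite dual. -/
def pullback : TopDual K A →ₗ[K] FiniteDual i where
  toFun φ := mk ((φ : A →ₗ[K] K) ∘ₗ f.toLinearMap) (by
    refine ⟨?_, fun s => ?_⟩
    -- A bilinear form coming from a tensor `∑ φₖ ⊗ ψₖ` has finite rank, and the translates of `φ ∘
    -- f` arise in this way from the tensor `dualMul K A φ`.
    · have hz : ∀ z : TopDual K A ⊗[K] TopDual K A, FiniteDimensional K
          (LinearMap.range ((tensorForm K A A z).compl₁₂ f.toLinearMap f.toLinearMap)) := by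
        intro z
        induction z with
        | zero =>
          refine Submodule.finiteDimensional_of_le (S₂ := ⊥) ?_
          rintro _ ⟨s, rfl⟩
          ext t
          simp
        | tmul φ ψ =>
          refine Submodule.finiteDimensional_of_le
            (S₂ := Submodule.span K {(ψ : A →ₗ[K] K) ∘ₗ f.toLinearMap}) ?_
          rintro _ ⟨s, rfl⟩
          rw [Submodule.mem_span_singleton]
          refine ⟨φ (f s), ?_⟩
          ext t
          simp
        | add a b ha hb =>
          refine Submodule.finiteDimensional_of_le
            (S₂ := LinearMap.range ((tensorForm K A A a).compl₁₂ f.toLinearMap f.toLinearMap) ⊔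
              LinearMap.range ((tensorForm K A A b).compl₁₂ f.toLinearMap f.toLinearMap)) ?_
          rintro _ ⟨s, rfl⟩
          have : (tensorForm K A A (a + b)).compl₁₂ f.toLinearMap f.toLinearMap s =
              (tensorForm K A A a).compl₁₂ f.toLinearMap f.toLinearMap s +
              (tensorForm K A A b).compl₁₂ f.toLinearMap f.toLinearMap s := by
            ext t
            simp
          rw [this]
          exact Submodule.add_mem_sup (LinearMap.mem_range_self _ s) (LinearMap.mem_range_self _ s)
      have h : translates ((φ : A →ₗ[K] K) ∘ₗ f.toLinearMap) =
          (tensorForm K A A (dualMul K A φ)).compl₁₂ f.toLinearMap f.toLinearMap := by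
        ext s t
        simp
      rw [h]
      exact hz _
    · simp only [LinearMap.comp_apply, AlgHom.toLinearMap_apply, map_mul]
      exact φ.continuous.comp (continuous_const.mul hf))
  map_add' _ _ := rfl
  map_smul' _ _ := rfl

@[simp] theorem pullback_apply (φ : TopDual K A) (s : S) : val (pullback f hf φ) s = φ (f s) := rfl

/-- The continuous linear extension of `f : S → A` to the completion. -/
def liftLinear : Completion i →L[K] A where
  toFun T := (bidualEquiv K A).symm (toDual i T ∘ₗ pullback f hf)
  map_add' T T' := by rw [map_add, LinearMap.add_comp, map_add]
  map_smul' c T := by rw [map_smul, LinearMap.smul_comp, map_smul]; rfl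
  cont := continuous_of_dual (K := K) fun φ => by
    simpa using continuous_toDual _

theorem dual_liftLinear (T : Completion i) (φ : TopDual K A) :
    φ (liftLinear f hf T) = toDual i T (pullback f hf φ) := by
  simp [liftLinear]

@[simp] theorem liftLinear_of (s : S) : liftLinear f hf (of i s) = f s :=
  ext_dual (K := K) fun φ => by rw [dual_liftLinear, toDual_of, pullback_apply]

/-- Pulling back along `f` turns left translation by `f s` on `A'` into translation by `s`; this is
the transposed statement. -/
theorem liftLinear_of_mul (s : S) (T : Completion i) :
    liftLinear f hf (of i s * T) = f s * liftLinear f hf T := by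
  apply ext_dual (K := K)
  intro φ
  have h : shift i s (pullback f hf φ) = pullback f hf (leftTrans (f s) φ) :=
    FiniteDual.ext fun t => by simp
  rw [← leftTrans_apply (f s) φ, dual_liftLinear, dual_liftLinear, mul_comm, toDual_apply, map_mul,
    Module.End.mul_apply, op_of, h, ← toDual_apply]

/-- For fixed `T'` both sides are continuous and linear in `T`, so density of `S` reduces the claim
to `liftLinear_of_mul`. -/
theorem liftLinear_mul (T T' : Completion i) :
    liftLinear f hf (T * T') = liftLinear f hf T * liftLinear f hf T' := by
  let F : Completion i →L[K] A :=
    ⟨(liftLinear f hf).toLinearMap ∘ₗ LinearMap.mulRight K T',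
      (liftLinear f hf).continuous.comp (continuous_id.mul continuous_const)⟩
  let F' : Completion i →L[K] A :=
    ⟨LinearMap.mulRight K (liftLinear f hf T') ∘ₗ (liftLinear f hf).toLinearMap,
      (liftLinear f hf).continuous.mul continuous_const⟩
  have h : F = F' := ext_of fun s => by
    exact (liftLinear_of_mul f hf s T').trans (by rw [← liftLinear_of f hf s]; rfl)
  exact DFunLike.congr_fun h T

/-- The extension of an algebra morphism `f : S → A`, continuous along `i`, to the completion. -/
def lift : Completion i →A[K] A where
  toAlgHom := AlgHom.ofLinearMap (liftLinear f hf).toLinearMap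
    (by
      have := liftLinear_of f hf 1
      rw [map_one (of i), map_one f] at this
      exact this) (liftLinear_mul f hf)
  cont := (liftLinear f hf).continuous

theorem lift_of (s : S) : lift f hf (of i s) = f s := liftLinear_of f hf s

end Lift

end Completion

end FiniteDual

/-! ### Existence of the weakly complete enveloping algebra -/

section Existence

attribute [local instance 100] LieRing.ofAssociativeRing

variable {g : Type u} [LieRing g] [LieAlgebra K g]

/-- The inclusion of `g` in `B` extends to the whole enveloping algebra; followed by the inclusion
of `B` it fixes `g`, so it is the identity and every element lies in `B`. -/
theorem universalEnvelopingAlgebra_eq_top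
    {B : Subalgebra K (UniversalEnvelopingAlgebra K g)}
    (hB : ∀ x, UniversalEnvelopingAlgebra.ι K x ∈ B) : B = ⊤ := by
  let j : g →ₗ⁅K⁆ B :=
    { toFun := fun x => ⟨UniversalEnvelopingAlgebra.ι K x, hB x⟩
      map_add' := fun x y => Subtype.ext (map_add _ x y)
      map_smul' := fun c x => Subtype.ext (map_smul _ c x)
      map_lie' := fun {x y} => Subtype.ext (LieHom.map_lie _ x y) }
  have h : B.val.comp (UniversalEnvelopingAlgebra.lift K j) =
      AlgHom.id K (UniversalEnvelopingAlgebra K g) := by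
    apply UniversalEnvelopingAlgebra.hom_ext
    ext x
    change ((UniversalEnvelopingAlgebra.lift K j) (UniversalEnvelopingAlgebra.ι K x)).1 =
      UniversalEnvelopingAlgebra.ι K x
    rw [UniversalEnvelopingAlgebra.lift_ι_apply]
    rfl
  refine (Algebra.eq_top_iff).2 fun a => ?_
  rw [← AlgHom.id_apply (R := K) a, ← h]
  exact Subtype.property _

/-- Two centralizer arguments: the centralizer of `g` contains `g`, so it is everything; hence the
centralizer of any `a` contains `g` and is everything as well. -/
theorem universalEnvelopingAlgebra_mul_comm [IsLieAbelian g]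
    (a b : UniversalEnvelopingAlgebra K g) : a * b = b * a := by
  have h1 : Subalgebra.centralizer K (Set.range (UniversalEnvelopingAlgebra.ι K : g → _)) = ⊤ := by
    refine universalEnvelopingAlgebra_eq_top fun x => ?_
    rw [Subalgebra.mem_centralizer_iff]
    rintro _ ⟨y, rfl⟩
    have h := LieHom.map_lie (UniversalEnvelopingAlgebra.ι K) y x
    rw [trivial_lie_zero, map_zero, LieRing.of_associative_ring_bracket] at h
    exact (sub_eq_zero.1 h.symm)
  have h2 : Subalgebra.centralizer K ({a} : Set (UniversalEnvelopingAlgebra K g)) = ⊤ := by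
    refine universalEnvelopingAlgebra_eq_top fun x => ?_
    rw [Subalgebra.mem_centralizer_iff]
    rintro _ rfl
    exact (((Subalgebra.mem_centralizer_iff K).1 (Algebra.eq_top_iff.1 h1 _)) _ ⟨x, rfl⟩).symm
  exact (Subalgebra.mem_centralizer_iff K).1 (Algebra.eq_top_iff.1 h2 b) a rfl

instance [IsLieAbelian g] : CommRing (UniversalEnvelopingAlgebra K g) where
  mul_comm := universalEnvelopingAlgebra_mul_comm

variable (K g) in
/-- The canonical linear map of `g` to its universal enveloping algebra. -/
def universalι : g →ₗ[K] UniversalEnvelopingAlgebra K g :=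
  (UniversalEnvelopingAlgebra.ι K : g →ₗ⁅K⁆ UniversalEnvelopingAlgebra K g)

theorem lift_universalι {A : Type v} [Ring A] [Algebra K A] (f : g →ₗ⁅K⁆ A) (x : g) :
    UniversalEnvelopingAlgebra.lift K f (universalι K g x) = f x :=
  UniversalEnvelopingAlgebra.lift_ι_apply K f x

variable (K g) in
/-- The weakly complete enveloping algebra of an abelian topological Lie algebra: the completion of
the universal enveloping algebra. -/
def abelianEnvelopingAlgebra [IsLieAbelian g] [TopologicalSpace g] : EnvelopingAlgebra K g where
  carrier := Completion (universalι K g)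
  ι := ((Completion.of (universalι K g) : _ →ₐ[K] Completion (universalι K g)) : _ →ₗ⁅K⁆ _).comp
    (UniversalEnvelopingAlgebra.ι K)
  continuous_ι := by exact Completion.continuous_of_comp (i := universalι K g)
  existsUnique_lift A _ _ _ _ _ f hf := by
    have hf' : Continuous fun x => UniversalEnvelopingAlgebra.lift K f (universalι K g x) :=
      hf.congr fun x => (lift_universalι f x).symm
    refine ⟨Completion.lift (UniversalEnvelopingAlgebra.lift K f) hf', fun x => ?_, fun F hF => ?_⟩
    · exact (Completion.lift_of _ hf' _).trans (lift_universalι f x)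
    -- Uniqueness has two stages: `g` determines `F` on the universal enveloping algebra, whose
    -- image is dense in the completion.
    · have h : F.toAlgHom.comp (Completion.of _) = UniversalEnvelopingAlgebra.lift K f := by
        apply UniversalEnvelopingAlgebra.hom_ext
        ext x
        exact (hF x).trans (lift_universalι f x).symm
      have h2 : F.toContinuousLinearMap = (Completion.lift _ hf').toContinuousLinearMap :=
        Completion.ext_of fun s => (AlgHom.congr_fun h s).trans (Completion.lift_of _ hf' s).symm
      exact ContinuousAlgHom.ext fun T => DFunLike.congr_fun h2 T

theorem abelianEnvelopingAlgebra_mul_comm [IsLieAbelian g] [TopologicalSpace g]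
    (a b : (abelianEnvelopingAlgebra K g).carrier) : a * b = b * a :=
  Completion.mul_comm (i := universalι K g) a b

/-! ### Consequences of the universal property for an arbitrary `U(g)` -/

namespace EnvelopingAlgebra

variable [TopologicalSpace g] (U : EnvelopingAlgebra K g)

theorem hom_ext {A : Type u} [Ring A] [Algebra K A] [TopologicalSpace A] [IsTopologicalRing A]
    [IsWeaklyComplete K A] {F F' : U.carrier →A[K] A} (h : ∀ x, F (U.ι x) = F' (U.ι x)) :
    F = F' := by
  let f : g →ₗ⁅K⁆ A := (F.toAlgHom : U.carrier →ₗ⁅K⁆ A).comp U.ι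
  have hf : Continuous f := F.continuous.comp U.continuous_ι
  exact (U.existsUnique_lift A f hf).unique (fun x => rfl) fun x => (h x).symm

/-- Continuous characters are determined by their values on `g`. -/
theorem character_ext {χ χ' : U.carrier →A[K] K} (h : ∀ x, χ (U.ι x) = χ' (U.ι x)) : χ = χ' := by
  -- The universal property tests only algebras in the universe of `g`, so the target `K` is
  -- replaced by its lift.
  let up : K →A[K] ULift.{u} K :=
    { toAlgHom := (ULift.algEquiv (R := K) (A := K)).symm.toAlgHom
      cont := continuous_uliftUp }
  have h2 : up.comp χ = up.comp χ' := U.hom_ext fun x => congrArg ULift.up (h x)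
  exact ContinuousAlgHom.ext fun a => congrArg ULift.down (DFunLike.congr_fun h2 a)

/-- The round trip through the constructed enveloping algebra fixes `g`, hence is the identity of
`U`; commutativity passes to this retract. -/
theorem mul_comm [IsLieAbelian g] (a b : U.carrier) : a * b = b * a := by
  let V := abelianEnvelopingAlgebra K g
  have h : (V.lift U.ι U.continuous_ι).comp (U.lift V.ι V.continuous_ι) =
      ContinuousAlgHom.id K U.carrier :=
    U.hom_ext fun x => by
      simp only [ContinuousAlgHom.comp_apply, lift_ι]
      rfl
  have h2 : ∀ c, V.lift U.ι U.continuous_ι (U.lift V.ι V.continuous_ι c) = c := fun c =>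
    DFunLike.congr_fun h c
  rw [← h2 (a * b), ← h2 (b * a), map_mul, abelianEnvelopingAlgebra_mul_comm, ← map_mul]

/-- The counit of `U` as a continuous algebra morphism. -/
def counitHom : U.carrier →A[K] K where
  toAlgHom := (ULift.algEquiv (R := K) (A := K)).toAlgHom.comp
    (U.lift (0 : g →ₗ⁅K⁆ ULift.{u} K) continuous_const).toAlgHom
  cont := U.counit.continuous

theorem counitHom_apply (a : U.carrier) : U.counitHom a = U.counit a := rfl

@[simp] theorem counit_ι (x : g) : U.counit (U.ι x) = 0 :=
  congrArg ULift.down (U.lift_ι (0 : g →ₗ⁅K⁆ ULift.{u} K) continuous_const x)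

theorem comul_ι (x : g) :
    U.comul (U.ι x) = WTensor.tmul (U.ι x) 1 + WTensor.tmul 1 (U.ι x) :=
  U.lift_ι _ _ x

@[simp] theorem antipode_ι (x : g) : U.antipode (U.ι x) = -U.ι x :=
  congrArg MulOpposite.unop (U.lift_ι (lieNegOp U.ι)
    (MulOpposite.continuous_op.comp U.continuous_ι.neg) x)

theorem antipode_one : U.antipode 1 = 1 :=
  congrArg MulOpposite.unop (map_one (U.lift (lieNegOp U.ι)
    (MulOpposite.continuous_op.comp U.continuous_ι.neg)))

theorem antipode_mul (a b : U.carrier) : U.antipode (a * b) = U.antipode b * U.antipode a :=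
  congrArg MulOpposite.unop (map_mul (U.lift (lieNegOp U.ι)
    (MulOpposite.continuous_op.comp U.continuous_ι.neg)) a b)

/-- For abelian `g`, the antipode is a continuous algebra morphism. -/
def antipodeHom [IsLieAbelian g] : U.carrier →A[K] U.carrier where
  toAlgHom := AlgHom.ofLinearMap U.antipode.toLinearMap U.antipode_one fun a b =>
    (U.antipode_mul a b).trans (U.mul_comm _ _)
  cont := U.antipode.continuous

theorem antipodeHom_apply [IsLieAbelian g] (a : U.carrier) : U.antipodeHom a = U.antipode a := rfl

/-- The composite of the counit and the unit of `U`. -/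
def unitCounitHom : U.carrier →A[K] U.carrier where
  toAlgHom := (Algebra.ofId K U.carrier).comp U.counitHom.toAlgHom
  cont := by
    have := continuousSMul_of_isWeaklyComplete (K := K) (E := U.carrier)
    exact (continuous_algebraMap K U.carrier).comp U.counit.continuous

theorem unitCounitHom_apply (a : U.carrier) :
    U.unitCounitHom a = algebraMap K U.carrier (U.counit a) := rfl

end EnvelopingAlgebra

end Existence

/-! ### Morphisms out of tensor products -/

namespace WTensor

section Linear

variable {E : Type u} {F : Type v} {Z : Type w} [AddCommGroup E] [Module K E] [TopologicalSpace E]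
  [AddCommGroup F] [Module K F] [TopologicalSpace F]
  [AddCommGroup Z] [Module K Z] [TopologicalSpace Z]

/-- Continuous linear maps on `E ⊗_W F` are determined by their values on elementary tensors. -/
theorem hom_ext [IsWeaklyComplete K Z] {f f' : WTensor K E F →L[K] Z}
    (h : ∀ a b, f (tmul a b) = f' (tmul a b)) : f = f' := by
  ext t
  apply ext_dual (K := K)
  intro ζ
  -- Every continuous functional on `E ⊗_W F` is evaluation at some `z ∈ E' ⊗ F'`, and `z` is
  -- determined by its bilinear form, that is, by the values on elementary tensors.
  obtain ⟨z, hz⟩ := (evalDual_bijective (K := K) (E := E) (F := F)).2 (ζ.comp f)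
  obtain ⟨z', hz'⟩ := (evalDual_bijective (K := K) (E := E) (F := F)).2 (ζ.comp f')
  have e : ∀ t, t.toDual z = ζ (f t) := fun t => DFunLike.congr_fun hz t
  have e' : ∀ t, t.toDual z' = ζ (f' t) := fun t => DFunLike.congr_fun hz' t
  have hzz : z = z' := by
    apply tensorForm_injective
    ext a b
    rw [← toDual_tmul_eq, ← toDual_tmul_eq, e, e', h]
  rw [← e, ← e', hzz]

/-- A separately continuous bilinear map on tensor products is determined by its values on elementary
tensors. -/
theorem hom_ext₂ {G : Type x} {H : Type y} [AddCommGroup G] [Module K G] [TopologicalSpace G]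
    [AddCommGroup H] [Module K H] [TopologicalSpace H] [IsWeaklyComplete K Z]
    {f f' : WTensor K E F →ₗ[K] WTensor K G H →ₗ[K] Z}
    (hl : ∀ s, Continuous fun t => f t s) (hl' : ∀ s, Continuous fun t => f' t s)
    (hr : ∀ t, Continuous (f t)) (hr' : ∀ t, Continuous (f' t))
    (h : ∀ a b c d, f (tmul a b) (tmul c d) = f' (tmul a b) (tmul c d)) : f = f' := by
  have h1 : ∀ c d t, f t (tmul c d) = f' t (tmul c d) := fun c d t =>
    DFunLike.congr_fun (hom_ext (f := ⟨f.flip (tmul c d), hl _⟩)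
      (f' := ⟨f'.flip (tmul c d), hl' _⟩) fun a b => h a b c d) t
  ext t s
  exact DFunLike.congr_fun (hom_ext (f := ⟨f t, hr t⟩) (f' := ⟨f' t, hr' t⟩)
    fun c d => h1 c d t) s

/-- The continuous linear map `t ↦ t ⊗ c`. -/
def tmulRight (E : Type u) [AddCommGroup E] [Module K E] [TopologicalSpace E] (c : F) :
    E →L[K] WTensor K E F where
  toFun t := tmul t c
  map_add' t s := add_tmul t s c
  map_smul' r t := smul_tmul r t c
  cont := continuous_iff.2 fun z => by
    simp only [toDual_tmul_eq]
    exact continuous_tensorForm_left z c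

@[simp] theorem tmulRight_apply (c : F) (t : E) : tmulRight E c t = (tmul t c : WTensor K E F) := rfl

end Linear

/-! ### Algebra morphisms out of tensor products -/

section Algebra

variable {A : Type u} {B : Type v} {Z : Type w} [Ring A] [Algebra K A] [TopologicalSpace A]
  [IsTopologicalRing A] [IsWeaklyComplete K A] [Ring B] [Algebra K B] [TopologicalSpace B]
  [IsTopologicalRing B] [IsWeaklyComplete K B] [Ring Z] [Algebra K Z] [TopologicalSpace Z]
  [IsTopologicalRing Z] [IsWeaklyComplete K Z]

/-- Both sides are separately continuous bilinear maps, so `hom_ext₂` applies. Three different maps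
are allowed for the sake of `assocHom`, where different elements are tensored on. -/
theorem map_mul_eq_of_tmul {f f' f'' : WTensor K A B →L[K] Z}
    (h : ∀ a c b d, f (tmul (a * c) (b * d)) = f' (tmul a b) * f'' (tmul c d))
    (t s : WTensor K A B) : f (t * s) = f' t * f'' s := by
  have key : (LinearMap.mul K (WTensor K A B)).compr₂ f.toLinearMap =
      (LinearMap.mul K Z).compl₁₂ f'.toLinearMap f''.toLinearMap := by
    refine hom_ext₂ (fun s => ?_) (fun s => ?_) (fun t => ?_) (fun t => ?_) fun a b c d => ?_
    · exact f.continuous.comp (continuous_id.mul continuous_const)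
    · exact f'.continuous.mul continuous_const
    · exact f.continuous.comp (continuous_const.mul continuous_id)
    · exact continuous_const.mul f''.continuous
    · change f (tmul a b * tmul c d) = f' (tmul a b) * f'' (tmul c d)
      rw [tmul_mul_tmul, h]
  exact LinearMap.congr_fun₂ key t s

/-- A continuous linear map on `A ⊗_W B` that is multiplicative on elementary tensors is an algebra
morphism. -/
def algHomOfTmul (f : WTensor K A B →L[K] Z) (h1 : f (tmul 1 1) = 1)
    (h : ∀ a c b d, f (tmul (a * c) (b * d)) = f (tmul a b) * f (tmul c d)) :
    WTensor K A B →A[K] Z where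
  toAlgHom := AlgHom.ofLinearMap f.toLinearMap (by rw [one_def]; exact h1) (map_mul_eq_of_tmul h)
  cont := f.continuous

@[simp] theorem algHomOfTmul_apply (f : WTensor K A B →L[K] Z) (h1 : f (tmul 1 1) = 1)
    (h : ∀ a c b d, f (tmul (a * c) (b * d)) = f (tmul a b) * f (tmul c d)) (t : WTensor K A B) :
    algHomOfTmul f h1 h t = f t := rfl

variable {A' : Type x} {B' : Type y} [Ring A'] [Algebra K A'] [TopologicalSpace A']
  [IsTopologicalRing A'] [IsWeaklyComplete K A'] [Ring B'] [Algebra K B'] [TopologicalSpace B']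
  [IsTopologicalRing B'] [IsWeaklyComplete K B']

/-- The tensor product of two continuous algebra morphisms. -/
def mapHom (f : A →A[K] A') (f' : B →A[K] B') : WTensor K A B →A[K] WTensor K A' B' :=
  algHomOfTmul (map f.toContinuousLinearMap f'.toContinuousLinearMap)
    (by simp [map_tmul, one_def])
    (fun a c b d => by simp [map_tmul, tmul_mul_tmul])

@[simp] theorem mapHom_apply (f : A →A[K] A') (f' : B →A[K] B') (t : WTensor K A B) :
    mapHom f f' t = map f.toContinuousLinearMap f'.toContinuousLinearMap t := rfl

variable (K A B Z) in
/-- The associativity morphism of weakly complete algebras. -/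
def assocHom : WTensor K (WTensor K A B) Z →A[K] WTensor K A (WTensor K B Z) :=
  algHomOfTmul (assoc K A B Z)
    (by rw [one_def, assoc_tmul, one_def, one_def])
    -- Here `t` and `s` are arbitrary elements of the inner tensor product; with `c` and `d` fixed,
    -- elementary `t` and `s` suffice.
    (fun t s c d => map_mul_eq_of_tmul (f := (assoc K A B Z).comp (tmulRight _ (c * d)))
      (f' := (assoc K A B Z).comp (tmulRight _ c)) (f'' := (assoc K A B Z).comp (tmulRight _ d))
      (fun a a' b b' => by simp [assoc_tmul, tmul_mul_tmul]) t s)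

@[simp] theorem assocHom_apply (t : WTensor K (WTensor K A B) Z) :
    assocHom K A B Z t = assoc K A B Z t := rfl

theorem leftUnitor_tmul (s : K) (a : A) : leftUnitor K A (tmul s a) = s • a := lift_tmul _ _ _ _

theorem rightUnitor_tmul (a : A) (s : K) : rightUnitor K A (tmul a s) = s • a := lift_tmul _ _ _ _

theorem mulMap_tmul (a b : A) : mulMap K A (tmul a b) = a * b := lift_tmul _ _ _ _

variable (K A) in
/-- The left unit morphism of a weakly complete algebra. -/
def leftUnitorHom : WTensor K K A →A[K] A :=
  algHomOfTmul (leftUnitor K A) (by simp [leftUnitor_tmul])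
    (fun a c b d => by simp [leftUnitor_tmul, mul_smul, smul_comm a c])

@[simp] theorem leftUnitorHom_apply (t : WTensor K K A) : leftUnitorHom K A t = leftUnitor K A t :=
  rfl

variable (K A) in
/-- The right unit morphism of a weakly complete algebra. -/
def rightUnitorHom : WTensor K A K →A[K] A :=
  algHomOfTmul (rightUnitor K A) (by simp [rightUnitor_tmul])
    (fun a c b d => by simp [rightUnitor_tmul, mul_smul, smul_comm b d])

@[simp] theorem rightUnitorHom_apply (t : WTensor K A K) :
    rightUnitorHom K A t = rightUnitor K A t := rfl

/-- The multiplication of a commutative weakly complete algebra, as a morphism of algebras. -/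
def mulHom (h : ∀ a b : A, a * b = b * a) : WTensor K A A →A[K] A :=
  algHomOfTmul (mulMap K A) (by simp [mulMap_tmul])
    (fun a c b d => by
      simp only [mulMap_tmul]
      rw [mul_assoc, mul_assoc, ← mul_assoc c, h c b, mul_assoc])

@[simp] theorem mulHom_apply (h : ∀ a b : A, a * b = b * a) (t : WTensor K A A) :
    mulHom h t = mulMap K A t := rfl

end Algebra

end WTensor

/-! ### The Jacobson radical of a commutative weakly complete algebra -/

section Jacobson

variable {A : Type u} [CommRing A] [Algebra K A] [TopologicalSpace A] [IsTopologicalRing A]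
  [IsWeaklyComplete K A]

/-- The map `a ↦ φ (a ·)`. -/
def orbitMap (φ : TopDual K A) : A →ₗ[K] TopDual K A where
  toFun a := leftTrans a φ
  map_add' a b := by ext c; simp [add_mul]
  map_smul' r a := by ext c; simp

theorem orbitMap_apply_apply (φ : TopDual K A) (a b : A) : orbitMap φ a b = φ (a * b) := rfl

/-- The functional `φ(a ·)` is the contraction of the tensor `dualMul K A φ` with `a`, and it lies
in the span of the finitely many right-hand factors of that tensor. -/
theorem finiteDimensional_range_orbitMap (φ : TopDual K A) :
    FiniteDimensional K (LinearMap.range (orbitMap φ)) := by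
  have hz : ∀ z : TopDual K A ⊗[K] TopDual K A, ∃ W : Submodule K (TopDual K A),
      FiniteDimensional K W ∧ ∀ a, contractLeft K A (TopDual K A) a z ∈ W := by
    intro z
    induction z with
    | zero => exact ⟨⊥, inferInstance, fun a => by simp⟩
    | tmul φ ψ =>
      exact ⟨Submodule.span K {ψ}, inferInstance, fun a => by
        simpa using Submodule.smul_mem _ _ (Submodule.mem_span_singleton_self ψ)⟩
    | add z w hz hw =>
      obtain ⟨W, hW, h⟩ := hz
      obtain ⟨W', hW', h'⟩ := hw
      exact ⟨W ⊔ W', inferInstance, fun a => by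
        rw [map_add]
        exact Submodule.add_mem_sup (h a) (h' a)⟩
  obtain ⟨W, hW, h⟩ := hz (dualMul K A φ)
  refine Submodule.finiteDimensional_of_le (S₂ := W) ?_
  rintro _ ⟨a, rfl⟩
  have := h a
  rwa [contractLeft_dualMul] at this

/-- An element without inverse annihilates a nonzero continuous functional. -/
theorem exists_leftTrans_eq_zero {a : A} (ha : ¬ IsUnit a) :
    ∃ φ : TopDual K A, φ ≠ 0 ∧ leftTrans a φ = 0 := by
  by_contra! h
  apply ha
  have hker : LinearMap.ker (leftTrans (K := K) a) = ⊥ :=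
    (Submodule.eq_bot_iff _).2 fun φ hφ => by
      by_contra hne
      exact h φ hne hφ
  -- If multiplication by `a` has injective transpose, any linear left inverse `G` yields an inverse
  -- of `a`: the functional `φ ↦ (G φ)(1)` is represented by some `b ∈ A`, and `φ(ab) = φ(1)` for
  -- all `φ`. No continuity of `G` is needed.
  obtain ⟨G, hG⟩ := LinearMap.exists_leftInverse_of_injective _ hker
  let b := (bidualEquiv K A).symm (bidual K A 1 ∘ₗ G)
  have hab : a * b = 1 := by
    apply ext_dual (K := K)
    intro φ
    rw [← leftTrans_apply a φ, apply_bidualEquiv_symm]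
    have := LinearMap.congr_fun hG φ
    simp only [LinearMap.comp_apply, LinearMap.id_apply] at this
    simp [this]
  exact IsUnit.of_mul_eq_one b hab

/-- Over an algebraically closed field, each element without inverse is annihilated by a continuous
character. -/
theorem exists_character_of_not_isUnit [IsAlgClosed K] {a : A} (ha : ¬ IsUnit a) :
    ∃ χ : A →A[K] K, χ a = 0 := by
  obtain ⟨φ, hφ, hL⟩ := exists_leftTrans_eq_zero (K := K) ha
  let I : Ideal A :=
    { carrier := {b | orbitMap φ b = 0}
      add_mem' := fun {b c} hb hc => by
        rw [Set.mem_ofPred_eq] at *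
        rw [map_add, hb, hc, add_zero]
      zero_mem' := map_zero _
      smul_mem' := fun c b hb => by
        rw [Set.mem_ofPred_eq] at *
        ext d
        have := DFunLike.congr_fun hb (c * d)
        rw [orbitMap_apply_apply] at this ⊢
        rw [smul_eq_mul, mul_comm c b, mul_assoc, this]
        rfl }
  have hI : I ≠ ⊤ := by
    rw [Ideal.ne_top_iff_one]
    intro h1
    apply hφ
    ext d
    have := DFunLike.congr_fun (show orbitMap φ 1 = 0 from h1) d
    rwa [orbitMap_apply_apply, one_mul] at this
  obtain ⟨m, hm, hIm⟩ := Ideal.exists_le_maximal I hI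
  -- The ideal `I` is the kernel of `orbitMap φ`, whose range is finite-dimensional; `A ⧸ m` is a
  -- quotient of `A ⧸ I`.
  have hfin : Module.Finite K (A ⧸ m) := by
    have := finiteDimensional_range_orbitMap φ
    have h1 : Module.Finite K (A ⧸ LinearMap.ker (orbitMap φ)) :=
      Module.Finite.equiv (orbitMap φ).quotKerEquivRange.symm
    have hle : LinearMap.ker (orbitMap φ) ≤
        LinearMap.ker (Ideal.Quotient.mkₐ K m).toLinearMap := fun b hb =>
      Ideal.Quotient.eq_zero_iff_mem.2 (hIm hb)
    refine Module.Finite.of_surjective ((LinearMap.ker (orbitMap φ)).liftQ _ hle) ?_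
    rw [← LinearMap.range_eq_top, Submodule.range_liftQ, LinearMap.range_eq_top]
    exact Ideal.Quotient.mkₐ_surjective K m
  have hbij : Function.Bijective (algebraMap K (A ⧸ m)) :=
    IsAlgClosed.algebraMap_bijective_of_isIntegral
  let χ : A →ₐ[K] K :=
    (AlgEquiv.ofBijective (Algebra.ofId K (A ⧸ m)) hbij).symm.toAlgHom.comp
      (Ideal.Quotient.mkₐ K m)
  have hχ : ∀ b ∈ m, χ b = 0 := fun b hb => by
    change (AlgEquiv.ofBijective (Algebra.ofId K (A ⧸ m)) hbij).symm (Ideal.Quotient.mk m b) = 0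
    rw [Ideal.Quotient.eq_zero_iff_mem.2 hb, map_zero]
  have hcont : Continuous χ := by
    -- Since `χ` vanishes on the kernel of `orbitMap φ`, it factors as `Λ ∘ orbitMap φ` with `Λ` a
    -- functional on `A'`. By duality `Λ` is evaluation at some `c`, so `χ(b) = φ(bc)` is
    -- continuous.
    have h1 : χ.toLinearMap ∈ (LinearMap.ker (orbitMap φ)).dualAnnihilator := by
      rw [Submodule.mem_dualAnnihilator]
      exact fun b hb => hχ b (hIm hb)
    rw [← LinearMap.range_dualMap_eq_dualAnnihilator_ker] at h1
    obtain ⟨Λ, hΛ⟩ := h1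
    obtain ⟨c, rfl⟩ := (bidualEquiv K A).surjective Λ
    have h2 : ∀ b, φ (b * c) = χ b := fun b => LinearMap.congr_fun hΛ b
    exact (φ.continuous.comp (continuous_id.mul continuous_const)).congr h2
  exact ⟨⟨χ, hcont⟩, hχ a (hIm hL)⟩

-- For `a` in the radical every continuous character takes the value `1` at `ab + 1`, which is then
-- a unit by `exists_character_of_not_isUnit`. Conversely, kernels of characters are maximal ideals.
variable (K A) in
theorem radical_eq_jacobson [IsAlgClosed K] : radical K A = Ring.jacobson A := by
  apply le_antisymm
  · intro a ha
    rw [← Ideal.jacobson_bot, Ideal.mem_jacobson_bot]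
    intro b
    by_contra hu
    obtain ⟨χ, hχ⟩ := exists_character_of_not_isUnit (K := K) hu
    simp [mem_radical.1 ha χ] at hχ
  · refine le_iInf fun χ => ?_
    have : (RingHom.ker χ).IsMaximal := RingHom.ker_isMaximal_of_surjective χ fun c =>
      ⟨algebraMap K A c, AlgHomClass.commutes χ c⟩
    exact Ring.jacobson_le_of_isMaximal _

end Jacobson

/-! ### Tensor products of powers -/

namespace WTensor

section Pow

variable {I : Type u} {J : Type v} {L : Type w}

/-- The `i`-th coordinate functional on `K ^ I`. -/
local notation "π" => ContinuousLinearMap.proj (R := K) (φ := fun _ => K)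

theorem ext_proj_left {F : Type v} [AddCommGroup F] [Module K F] [TopologicalSpace F]
    {t s : WTensor K (I → K) F}
    (h : ∀ i (ψ : TopDual K F), t.toDual (π i ⊗ₜ ψ) = s.toDual (π i ⊗ₜ ψ)) : t = s := by
  refine WithConv.ofConv_injective (TensorProduct.ext' fun α ψ => ?_)
  change t.toDual (α ⊗ₜ ψ) = s.toDual (α ⊗ₜ ψ)
  induction mem_span_proj K α using Submodule.span_induction with
  | mem β hβ => obtain ⟨i, rfl⟩ := hβ; exact h i ψ
  | zero => simp
  | add a b _ _ ha hb => simp [ha, hb, TensorProduct.add_tmul]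
  | smul c a _ ha => simp [ha, ← TensorProduct.smul_tmul']

theorem ext_proj {t s : WTensor K (I → K) (J → K)}
    (h : ∀ i j, t.toDual (π i ⊗ₜ π j) = s.toDual (π i ⊗ₜ π j)) : t = s :=
  (powEquiv K I J).symm.injective (funext fun p => h p.1 p.2)

/-- Contracting with the `i`-th coordinate leaves an element of `K^J ⊗_W K^L`, to which `ext_proj`
applies. This reduces coassociativity in `V(g)` to triples of coordinates. -/
theorem ext_proj_proj {t s : WTensor K (I → K) (WTensor K (J → K) (L → K))}
    (h : ∀ i j l, t.toDual (π i ⊗ₜ evalDual K _ _ (π j ⊗ₜ π l)) =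
      s.toDual (π i ⊗ₜ evalDual K _ _ (π j ⊗ₜ π l))) : t = s := by
  refine ext_proj_left fun i Ω => ?_
  obtain ⟨z, rfl⟩ := (evalDual_bijective (K := K) (E := J → K) (F := L → K)).2 Ω
  have key : (ofDual (t.toDual ∘ₗ TensorProduct.mk K _ _ (π i) ∘ₗ evalDual K _ _) :
      WTensor K (J → K) (L → K)) =
      ofDual (s.toDual ∘ₗ TensorProduct.mk K _ _ (π i) ∘ₗ evalDual K _ _) :=
    ext_proj fun j l => h i j l
  exact LinearMap.congr_fun (congrArg toDual key) z

@[simp] theorem toDual_powEquiv (θ : I × J → K) (i : I) (j : J) :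
    (powEquiv K I J θ).toDual (π i ⊗ₜ π j) = θ (i, j) := rfl

/-- Coordinates of `K^I` are multiplicative, which means group-like in the dual coalgebra. Hence the
product on `K^I ⊗_W K^J` is computed coordinatewise. -/
theorem dualMul_proj (i : I) : dualMul K (I → K) (π i) = π i ⊗ₜ π i := by
  apply tensorForm_injective
  ext a b
  simp

theorem toDual_mul_proj (t s : WTensor K (I → K) (J → K)) (i : I) (j : J) :
    (t * s).toDual (π i ⊗ₜ π j) = t.toDual (π i ⊗ₜ π j) * s.toDual (π i ⊗ₜ π j) := by
  rw [toDual_mul, TensorProduct.comul_tmul]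
  change LinearMap.mul' K K (TensorProduct.map t.toDual s.toDual
    (TensorProduct.AlgebraTensorModule.tensorTensorTensorComm K K K K _ _ _ _
      (dualMul K (I → K) (π i) ⊗ₜ dualMul K (J → K) (π j)))) = _
  rw [dualMul_proj, dualMul_proj]
  simp

theorem toDual_one_proj (i : I) (j : J) :
    (1 : WTensor K (I → K) (J → K)).toDual (π i ⊗ₜ π j) = 1 := by
  rw [one_def]
  simp

end Pow

/-- The associator is the transpose of the reassociation of triple tensors of functionals. -/
theorem toDual_assoc {E : Type u} {F : Type v} {G : Type w} [AddCommGroup E] [Module K E]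
    [TopologicalSpace E] [AddCommGroup F] [Module K F] [TopologicalSpace F] [AddCommGroup G]
    [Module K G] [TopologicalSpace G] (t : WTensor K (WTensor K E F) G) (α : TopDual K E)
    (β : TopDual K F) (γ : TopDual K G) :
    (assoc K E F G t).toDual (α ⊗ₜ evalDual K F G (β ⊗ₜ γ)) =
      t.toDual (evalDual K E F (α ⊗ₜ β) ⊗ₜ γ) := by
  have h : assocDual K E F G (α ⊗ₜ evalDual K F G (β ⊗ₜ γ)) = evalDual K E F (α ⊗ₜ β) ⊗ₜ γ := by
    have h1 : (evalDualEquiv K F G).symm (evalDual K F G (β ⊗ₜ γ)) = β ⊗ₜ γ :=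
      (evalDualEquiv K F G).symm_apply_apply _
    simp only [assocDual, LinearEquiv.trans_apply, LinearEquiv.lTensor_tmul, h1,
      TensorProduct.assoc_symm_tmul, LinearEquiv.rTensor_tmul]
    rfl
  exact congrArg t.toDual h

theorem dual_lift {E : Type u} {F : Type v} {Z : Type w} [AddCommGroup E] [Module K E]
    [TopologicalSpace E] [AddCommGroup F] [Module K F] [TopologicalSpace F] [AddCommGroup Z]
    [Module K Z] [TopologicalSpace Z] [IsWeaklyComplete K E] [IsWeaklyComplete K F]
    [IsWeaklyComplete K Z] (b : E →ₗ[K] F →ₗ[K] Z) (hb : Continuous fun p : E × F => b p.1 p.2)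
    (t : WTensor K E F) (ζ : TopDual K Z) : ζ (lift b hb t) = t.toDual (dualOfBilin K b hb ζ) :=
  apply_bidualEquiv_symm _ _

end WTensor

/-! ### The Hopf algebra `V(g)` -/

section PowerHopf

open WTensor

local notation "π" => ContinuousLinearMap.proj (R := K) (φ := fun _ => K)

theorem apply_leftUnitor {A : Type u} [Ring A] [Algebra K A] [TopologicalSpace A]
    [IsTopologicalRing A] [IsWeaklyComplete K A] (t : WTensor K K A) (ζ : TopDual K A) :
    ζ (leftUnitor K A t) = t.toDual (ContinuousLinearMap.id K K ⊗ₜ ζ) := by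
  refine (dual_lift _ _ t ζ).trans (congrArg t.toDual (tensorForm_injective ?_))
  ext a
  exact (tensorForm_dualOfBilin _ _ ζ 1 a).trans (by simp)

theorem apply_rightUnitor {A : Type u} [Ring A] [Algebra K A] [TopologicalSpace A]
    [IsTopologicalRing A] [IsWeaklyComplete K A] (t : WTensor K A K) (ζ : TopDual K A) :
    ζ (rightUnitor K A t) = t.toDual (ζ ⊗ₜ ContinuousLinearMap.id K K) := by
  refine (dual_lift _ _ t ζ).trans (congrArg t.toDual (tensorForm_injective ?_))
  ext a
  exact (tensorForm_dualOfBilin _ _ ζ a 1).trans (by simp)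

theorem mulMap_apply {I : Type u} (t : WTensor K (I → K) (I → K)) (i : I) :
    mulMap K (I → K) t i = t.toDual (π i ⊗ₜ π i) :=
  (dual_lift _ _ t (π i)).trans (congrArg t.toDual (dualMul_proj i))

variable {g : Type u} [AddCommGroup g] [Module K g] [TopologicalSpace g]

@[simp] theorem toDual_powerHopf_comul (a : PowerAlgebra K g) (ω₁ ω₂ : TopDual K g) :
    ((powerHopf K g).comul a).toDual (π ω₁ ⊗ₜ π ω₂) = a (ω₁ + ω₂) := rfl

theorem evalDual_comp_powerHopf_comul (ω₁ ω₂ : TopDual K g) :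
    (evalDual K (PowerAlgebra K g) (PowerAlgebra K g) (π ω₁ ⊗ₜ π ω₂)).comp (powerHopf K g).comul =
      π (ω₁ + ω₂) := rfl

-- At the coordinates `ω ∈ g'` the axioms become associativity, neutral element and inverses in the
-- additive group `g'`.
variable (K g) in
theorem isSymmetricHopf_powerHopf : (powerHopf K g).IsSymmetricHopf where
  comul_one := ext_proj fun i j => by simp [toDual_one_proj]
  comul_mul a b := ext_proj fun i j => by simp [toDual_mul_proj]
  counit_one := rfl
  counit_mul _ _ := rfl
  coassoc a := ext_proj_proj fun i j l => by
    rw [toDual_assoc, toDual_map, toDual_map, TensorProduct.map_tmul, TensorProduct.map_tmul,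
      dualMap_apply, dualMap_apply, dualMap_apply, dualMap_apply, evalDual_comp_powerHopf_comul,
      evalDual_comp_powerHopf_comul]
    exact congrArg a (add_assoc i j l)
  counit_comul a := funext fun ω => by
    refine (apply_leftUnitor _ (π ω)).trans ?_
    exact congrArg a (zero_add ω)
  comul_counit a := funext fun ω => by
    refine (apply_rightUnitor _ (π ω)).trans ?_
    exact congrArg a (add_zero ω)
  antipode_mul a := funext fun ω => by
    refine (mulMap_apply _ ω).trans ?_
    exact congrArg a (neg_add_cancel ω)
  mul_antipode a := funext fun ω => by
    refine (mulMap_apply _ ω).trans ?_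
    exact congrArg a (add_neg_cancel ω)

variable (K g) in
/-- The comultiplication of `V(g)` as a morphism of algebras. -/
def powerComulHom : PowerAlgebra K g →A[K] WTensor K (PowerAlgebra K g) (PowerAlgebra K g) where
  toAlgHom := AlgHom.ofLinearMap (powerHopf K g).comul.toLinearMap
    (isSymmetricHopf_powerHopf K g).comul_one (isSymmetricHopf_powerHopf K g).comul_mul
  cont := (powerHopf K g).comul.continuous

variable (K g) in
/-- The symmetry of `V(g)` as a morphism of algebras. -/
def powerAntipodeHom : PowerAlgebra K g →A[K] PowerAlgebra K g where
  toAlgHom := AlgHom.ofLinearMap (powerHopf K g).antipode.toLinearMap rfl fun _ _ => rfl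
  cont := (powerHopf K g).antipode.continuous

end PowerHopf

/-! ### The Hopf algebra `U(g)` -/

namespace EnvelopingAlgebra

open WTensor

variable {g : Type u} [LieRing g] [LieAlgebra K g] [IsLieAbelian g] [TopologicalSpace g]
  (U : EnvelopingAlgebra K g)

/-- Both sides of each diagram are continuous algebra morphisms on `U`, so it suffices to compare
them at `ι x`. For the two antipode diagrams this uses commutativity of `U`, through `mulHom` and
`antipodeHom`. -/
theorem isSymmetricHopf_hopf : U.hopf.IsSymmetricHopf where
  comul_one := map_one U.comul
  comul_mul := map_mul U.comul
  counit_one := map_one U.counitHom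
  counit_mul := map_mul U.counitHom
  coassoc a := by
    have h : (assocHom K _ _ _).comp ((mapHom U.comul (ContinuousAlgHom.id K _)).comp U.comul) =
        (mapHom (ContinuousAlgHom.id K _) U.comul).comp U.comul := U.hom_ext fun x => by
      simp only [ContinuousAlgHom.comp_apply, comul_ι, map_add, mapHom_apply, map_tmul,
        assocHom_apply, ContinuousAlgHom.coe_toContinuousLinearMap, ContinuousAlgHom.id_apply,
        add_tmul, tmul_add, map_one, one_def, assoc_tmul, add_assoc]
    exact DFunLike.congr_fun h a
  counit_comul a := by
    have h : (leftUnitorHom K _).comp ((mapHom U.counitHom (ContinuousAlgHom.id K _)).comp U.comul) =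
        ContinuousAlgHom.id K _ := U.hom_ext fun x => by
      simp only [ContinuousAlgHom.comp_apply, comul_ι, map_add, mapHom_apply, map_tmul,
        leftUnitorHom_apply, ContinuousAlgHom.coe_toContinuousLinearMap, ContinuousAlgHom.id_apply,
        leftUnitor_tmul, counitHom_apply, counit_ι, zero_smul, zero_add]
      rw [← counitHom_apply, map_one, one_smul]
    exact DFunLike.congr_fun h a
  comul_counit a := by
    have h : (rightUnitorHom K _).comp ((mapHom (ContinuousAlgHom.id K _) U.counitHom).comp U.comul) =
        ContinuousAlgHom.id K _ := U.hom_ext fun x => by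
      simp only [ContinuousAlgHom.comp_apply, comul_ι, map_add, mapHom_apply, map_tmul,
        rightUnitorHom_apply, ContinuousAlgHom.coe_toContinuousLinearMap, ContinuousAlgHom.id_apply,
        rightUnitor_tmul, counitHom_apply, counit_ι, zero_smul, add_zero]
      rw [← counitHom_apply, map_one, one_smul]
    exact DFunLike.congr_fun h a
  antipode_mul a := by
    have h : (mulHom U.mul_comm).comp ((mapHom U.antipodeHom (ContinuousAlgHom.id K _)).comp U.comul) =
        U.unitCounitHom := U.hom_ext fun x => by
      simp only [ContinuousAlgHom.comp_apply, comul_ι, map_add, mapHom_apply, map_tmul,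
        mulHom_apply, ContinuousAlgHom.coe_toContinuousLinearMap, ContinuousAlgHom.id_apply,
        mulMap_tmul, antipodeHom_apply, antipode_ι, antipode_one, unitCounitHom_apply, counit_ι,
        map_zero, one_mul, mul_one, neg_add_cancel]
    exact DFunLike.congr_fun h a
  mul_antipode a := by
    have h : (mulHom U.mul_comm).comp ((mapHom (ContinuousAlgHom.id K _) U.antipodeHom).comp U.comul) =
        U.unitCounitHom := U.hom_ext fun x => by
      simp only [ContinuousAlgHom.comp_apply, comul_ι, map_add, mapHom_apply, map_tmul,
        mulHom_apply, ContinuousAlgHom.coe_toContinuousLinearMap, ContinuousAlgHom.id_apply,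
        mulMap_tmul, antipodeHom_apply, antipode_ι, antipode_one, unitCounitHom_apply, counit_ι,
        map_zero, one_mul, mul_one, add_neg_cancel]
    exact DFunLike.congr_fun h a

/-! ### The canonical morphism `U(g) → V(g)` -/

/-- The `ω`-th coordinate of the canonical morphism `U(g) → V(g)`: the character of `U(g)` extending
the functional `ω` on `g`. -/
def character (ω : TopDual K g) : U.carrier →A[K] K where
  toAlgHom := (Pi.evalAlgHom K (fun _ : TopDual K g => K) ω).comp U.toPower.toAlgHom
  cont := (continuous_apply ω).comp U.toPower.continuous

@[simp] theorem character_apply (ω : TopDual K g) (a : U.carrier) :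
    U.character ω a = U.toPower a ω := rfl

theorem character_injective : Function.Injective U.character := by
  intro ω ω' h
  ext x
  rw [← U.toPower_ι, ← U.toPower_ι, ← character_apply, h, character_apply]

/-- Take for `ω` the restriction of `χ` to `g`; continuous characters with the same restriction
coincide. -/
theorem exists_eq_character (χ : U.carrier →A[K] K) : ∃ ω, χ = U.character ω := by
  let ω : TopDual K g :=
    ⟨χ.toAlgHom.toLinearMap ∘ₗ (U.ι : g →ₗ[K] U.carrier), χ.continuous.comp U.continuous_ι⟩
  exact ⟨ω, U.character_ext fun x => by rw [character_apply, U.toPower_ι]; rfl⟩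

/-- Dedekind's theorem on distinct multiplicative maps into a field, transported from functions on
`U` to continuous functionals. -/
theorem linearIndependent_character :
    LinearIndependent K fun ω => (U.character ω).toContinuousLinearMap := by
  let coe : TopDual K U.carrier →ₗ[K] U.carrier → K :=
    { toFun := fun φ => φ
      map_add' := fun _ _ => rfl
      map_smul' := fun _ _ => rfl }
  apply LinearIndependent.of_comp coe
  refine (linearIndependent_monoidHom U.carrier K).comp
    (fun ω => (U.character ω : U.carrier →* K)) fun ω ω' h => U.character_injective ?_
  exact ContinuousAlgHom.ext fun a => DFunLike.congr_fun h a

/-- By linear independence, `ω ↦ v ω` prescribes a functional on the span of the characters. Any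
linear extension to `U'` is evaluation at an element of `U`, and that element is a preimage of `v`.
-/
theorem toPower_surjective : Function.Surjective U.toPower := by
  intro v
  let b := Module.Basis.span U.linearIndependent_character
  obtain ⟨Φ, hΦ⟩ := LinearMap.exists_extend (b.constr K v)
  refine ⟨(bidualEquiv K U.carrier).symm Φ, funext fun ω => ?_⟩
  have h1 : (U.character ω).toContinuousLinearMap ((bidualEquiv K U.carrier).symm Φ) =
      Φ (U.character ω).toContinuousLinearMap := apply_bidualEquiv_symm _ _
  refine h1.trans ?_
  have h2 := LinearMap.congr_fun hΦ (b ω)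
  rw [Module.Basis.constr_basis] at h2
  rw [← h2]
  exact congrArg (fun x => Φ (Subtype.val x))
    (Module.Basis.span_apply U.linearIndependent_character ω).symm

theorem isHopfMorphism_toPower : IsHopfMorphism U.hopf (powerHopf K g) U.toPower where
  map_comul a := by
    have h : (powerComulHom K g).comp U.toPower = (mapHom U.toPower U.toPower).comp U.comul :=
      U.hom_ext fun x => by
        simp only [ContinuousAlgHom.comp_apply, comul_ι, map_add, mapHom_apply, map_tmul,
          ContinuousAlgHom.coe_toContinuousLinearMap, map_one]
        refine ext_proj fun ω₁ ω₂ => ?_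
        refine (U.toPower_ι x (ω₁ + ω₂)).trans ?_
        simp [U.toPower_ι]
    exact DFunLike.congr_fun h a
  map_counit a := by
    -- The coidentity is the character attached to the zero functional, since both vanish on `g`.
    have h : U.character 0 = U.counitHom := U.character_ext fun x => by
      rw [character_apply, U.toPower_ι, counitHom_apply, counit_ι]
      rfl
    exact DFunLike.congr_fun h a
  map_antipode a := by
    have h : (powerAntipodeHom K g).comp U.toPower = U.toPower.comp U.antipodeHom :=
      U.hom_ext fun x => funext fun ω => by
        rw [ContinuousAlgHom.comp_apply, ContinuousAlgHom.comp_apply, antipodeHom_apply, antipode_ι,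
          map_neg, Pi.neg_apply, U.toPower_ι]
        exact U.toPower_ι x (-ω)
    exact DFunLike.congr_fun h a

/-- The coordinates of `q` are all the continuous characters, so vanishing under `q` means vanishing
under each of them. -/
theorem ker_toPower : RingHom.ker U.toPower = radical K U.carrier := by
  ext a
  rw [mem_radical, RingHom.mem_ker]
  constructor
  · intro h χ
    obtain ⟨ω, rfl⟩ := U.exists_eq_character χ
    rw [character_apply, h, Pi.zero_apply]
  · intro h
    exact funext fun ω => h (U.character ω)

theorem radical_eq_jacobson [IsAlgClosed K] :
    radical K U.carrier = Ring.jacobson U.carrier :=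
  letI : CommRing U.carrier := { U.ring with mul_comm := U.mul_comm }
  WeaklyComplete.radical_eq_jacobson K U.carrier

end EnvelopingAlgebra

end

end WeaklyComplete

/-! ### The proposition -/

open WeaklyComplete in
theorem proposition4p7 (K : Type) [RCLike K] (g : Type u) [LieRing g] [LieAlgebra K g]
    [IsLieAbelian g] [TopologicalSpace g] [IsWeaklyComplete K g] :
    Nonempty (EnvelopingAlgebra K g) ∧
    ∀ U : EnvelopingAlgebra K g,
      U.hopf.IsSymmetricHopf ∧
      (powerHopf K g).IsSymmetricHopf ∧
      Function.Surjective U.toPower ∧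
      IsHopfMorphism U.hopf (powerHopf K g) U.toPower ∧
      RingHom.ker U.toPower = radical K U.carrier ∧
      (IsAlgClosed K → RingHom.ker U.toPower = Ring.jacobson U.carrier) :=
  ⟨⟨abelianEnvelopingAlgebra K g⟩, fun U => ⟨U.isSymmetricHopf_hopf, isSymmetricHopf_powerHopf K g,
    U.toPower_surjective, U.isHopfMorphism_toPower, U.ker_toPower,
    fun _ => U.ker_toPower.trans U.radical_eq_jacobson⟩⟩
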